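/- Let $n\ge 2$, $k,m,N\in\mathbb N$ (all $\ge 1$), let $X\subset\mathbb R^n$ be a non-empty connected open set, and let $A=\sum_{|\alpha|\le m}a_\alpha(x)\partial^\alpha$ be a linear differential operator on $X$ whose coefficients are $(k\times k)$-matrices of real-valued $C^\infty(X)$-functions. Assume that $A$ is (Petrovskii) elliptic, i.e. the matrix $\sum_{|\alpha|=m}a_\alpha(x)(i\zeta)^\alpha$ is invertible for all $x\in X$ and $\zeta\in\mathbb R^n\setminus\{0\}$, and that both $A$ and its formal adjoint $A^*v=\sum_{|\alpha|\le m}(-1)^{|\alpha|}\partial^\alpha(a_\alpha^Tv)$ have the unique continuation property on $X$: for every domain (non-empty connected open set) $U\subset X$, each distributional solution on $U$ of the corresponding homogeneous equation that vanishes on a non-empty open subset of $U$ vanishes on $U$. Let $D$ be a domain whose closure is a compact subset of $X$, with $C^\infty$-smooth boundary, and such that $X\setminus D$ has no compact connected components. Let $s\in\mathbb Z$ and $1<p<\infty$, $\frac1p+\frac1{p'}=1$. For $s\ge0$ let $W^{s,p}(D)$ be the Sobolev space with norm $\|w\|_{W^{s,p}(D)}=\big(\sum_{|\alpha|\le s}\|\partial^\alpha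 w\|^p_{L^p(D)}\big)^{1/p}$; for $s<0$ let $W^{s,p}(D)$ be the space of distributions $w$ on $D$ with finite norm $\|w\|_{W^{s,p}(D)}=\sup\{|\langle w,\varphi\rangle|:\varphi\in C_0^\infty(D),\ \|\varphi\|_{W^{-s,p'}(D)}\le1\}$. Put $\|u\|_{[W^{s,p}(D)]^k}=\big(\sum_{j=1}^k\|u_j\|^p_{W^{s,p}(D)}\big)^{1/p}$, and let $S_A^{s,p}(D)$ be the space of all real $u\in[W^{s,p}(D)]^k$ satisfying $Au=0$ in $D$ in the sense of distributions, with this norm. Let $M:S_A^{s,p}(D)\to\mathbb R^N$ be a continuous linear surjection, let $F:\mathbb R^N\to(-\infty,+\infty]$ be proper, convex, lower semicontinuous and coercive ($F(x)\to+\infty$ as $|x|\to\infty$), let $b>0$, and put $$\mathcal F(u)=F(Mu)+b\,\|u\|_{[W^{s,p}(D)]^k},\qquad u\in S_A^{s,p}(D).$$ Then $\mathcal F$ attains its minimum over $S_A^{s,p}(D)$. If, moreover, $F$ is strictly convex (on the set where it is finite), then the minimizer is unique. -/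

import Mathlib

open Set Filter Topology MeasureTheory TopologicalSpace
open scoped ENNReal ContDiff Distributions LineDeriv

noncomputable section

namespace SobSol

/-! ### Multi-indices, partial derivatives, differential operators -/

/-- The multi-indices `α` with `|α| ≤ r`. -/
def multiIdx (n r : ℕ) : Finset (Fin n → ℕ) :=
  (Finset.range (r + 1)).biUnion fun i => Finset.piAntidiag Finset.univ i

theorem mem_multiIdx {n r : ℕ} {α : Fin n → ℕ} : α ∈ multiIdx n r ↔ ∑ i, α i ≤ r := by
  simp [multiIdx]

/-- `∂^α = ∂₁^{α₁} ⋯ ∂ₙ^{αₙ}`, on test functions or on distributions. -/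
def pderiv {n : ℕ} (V : Type*) [AddCommGroup V] [Module ℝ V] [TopologicalSpace V]
    [LineDeriv (EuclideanSpace ℝ (Fin n)) V V] [LineDerivAdd (EuclideanSpace ℝ (Fin n)) V V]
    [LineDerivSMul ℝ (EuclideanSpace ℝ (Fin n)) V V]
    [ContinuousLineDeriv (EuclideanSpace ℝ (Fin n)) V V]
    (α : Fin n → ℕ) : V →L[ℝ] V :=
  ((List.finRange n).map fun j =>
    (LineDeriv.lineDerivOpCLM ℝ V (EuclideanSpace.single j (1 : ℝ))) ^ α j).prod

theorem pderiv_zero {n : ℕ} (V : Type*) [AddCommGroup V] [Module ℝ V] [TopologicalSpace V]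
    [LineDeriv (EuclideanSpace ℝ (Fin n)) V V] [LineDerivAdd (EuclideanSpace ℝ (Fin n)) V V]
    [LineDerivSMul ℝ (EuclideanSpace ℝ (Fin n)) V V]
    [ContinuousLineDeriv (EuclideanSpace ℝ (Fin n)) V V] (v : V) :
    pderiv V (0 : Fin n → ℕ) v = v := by
  have h : ((List.finRange n).map fun j =>
      (LineDeriv.lineDerivOpCLM ℝ V (EuclideanSpace.single j (1 : ℝ))) ^ (0 : Fin n → ℕ) j).prod
      = (1 : V →L[ℝ] V) := List.prod_eq_one (by simp)
  rw [pderiv, h]; rfl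

/-- The product `a φ` of a test function on `Ω` with a function that is smooth on `Ω`. -/
def mulTest {n : ℕ} {Ω : Opens (EuclideanSpace ℝ (Fin n))} (a : EuclideanSpace ℝ (Fin n) → ℝ)
    (ha : ContDiffOn ℝ ∞ a Ω) (φ : 𝓓(Ω, ℝ)) : 𝓓(Ω, ℝ) where
  toFun x := a x * φ x
  contDiff' := by
    refine contDiff_iff_contDiffAt.2 fun x => ?_
    by_cases hx : x ∈ (Ω : Set (EuclideanSpace ℝ (Fin n)))
    · exact (ha.contDiffAt (Ω.isOpen.mem_nhds hx)).mul φ.contDiff.contDiffAt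
    · have hx' : x ∉ tsupport φ := fun h => hx (φ.tsupport_subset h)
      have : (fun x => a x * φ x) =ᶠ[𝓝 x] fun _ => 0 := by
        filter_upwards [(isClosed_tsupport φ).isOpen_compl.mem_nhds hx'] with y hy
        simp [image_eq_zero_of_notMem_tsupport hy]
      exact contDiffAt_const.congr_of_eventuallyEq this
  hasCompactSupport' := φ.hasCompactSupport.mul_left
  tsupport_subset' := (tsupport_mul_subset_right).trans φ.tsupport_subset

/-- A linear differential operator `A = ∑_{|α| ≤ m} a_α(x) ∂^α` on `X`, whose coefficients are real
`k × k` matrices of functions smooth on `X`. Only the `a_α` with `|α| ≤ m`, and only their values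
on `X`, are ever used. -/
structure DiffOp (n k m : ℕ) (X : Opens (EuclideanSpace ℝ (Fin n))) where
  coeff : (Fin n → ℕ) → EuclideanSpace ℝ (Fin n) → Matrix (Fin k) (Fin k) ℝ
  smooth : ∀ α i j, ContDiffOn ℝ ∞ (fun x => coeff α x i j) X

namespace DiffOp

variable {n k m : ℕ} {X : Opens (EuclideanSpace ℝ (Fin n))} (A : DiffOp n k m X)

/-- The principal symbol `σ(A)(x, ζ) = ∑_{|α| = m} a_α(x) (iζ)^α`. -/
def symbol (x ζ : EuclideanSpace ℝ (Fin n)) : Matrix (Fin k) (Fin k) ℂ :=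
  ∑ α ∈ Finset.piAntidiag (Finset.univ : Finset (Fin n)) m,
    (∏ j, (Complex.I * (ζ j : ℂ)) ^ α j) • (A.coeff α x).map (fun t : ℝ => (t : ℂ))

/-- (Petrovskii) ellipticity on `X`. -/
def IsElliptic : Prop :=
  ∀ x ∈ X, ∀ ζ : EuclideanSpace ℝ (Fin n), ζ ≠ 0 → IsUnit (A.symbol x ζ)

/-- The coefficients multiply test functions on every open `U ⊆ X`. -/
def mulCoeff {U : Opens (EuclideanSpace ℝ (Fin n))} (hU : U ≤ X) (α : Fin n → ℕ) (i j : Fin k)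
    (φ : 𝓓(U, ℝ)) : 𝓓(U, ℝ) :=
  mulTest (fun x => A.coeff α x i j) ((A.smooth α i j).mono hU) φ

/-- `A u = 0` in `U` in the sense of distributions. The left-hand side is the value at `φ` of the
`i`-th component `∑_α ∑_j (a_α)_{ij} ∂^α u_j` of `A u`. -/
def IsSolution (U : Opens (EuclideanSpace ℝ (Fin n))) (hU : U ≤ X) (u : Fin k → 𝓓'(U, ℝ)) : Prop :=
  ∀ (i : Fin k) (φ : 𝓓(U, ℝ)),
    ∑ α ∈ multiIdx n m, ∑ j, (pderiv 𝓓'(U, ℝ) α (u j)) (A.mulCoeff hU α i j φ) = 0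

/-- `A* v = 0` in `U` in the sense of distributions, for the formal adjoint
`A* v = ∑_α (-1)^{|α|} ∂^α (a_αᵀ v)`. The left-hand side is the value at `φ` of the `j`-th component
of `A* v`: the sign `(-1)^{|α|}` cancels against the one in `⟨∂^α T, φ⟩ = (-1)^{|α|} ⟨T, ∂^α φ⟩`. -/
def IsAdjointSolution (U : Opens (EuclideanSpace ℝ (Fin n))) (hU : U ≤ X)
    (v : Fin k → 𝓓'(U, ℝ)) : Prop :=
  ∀ (j : Fin k) (φ : 𝓓(U, ℝ)),
    ∑ α ∈ multiIdx n m, ∑ i, v i (A.mulCoeff hU α i j (pderiv 𝓓(U, ℝ) α φ)) = 0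

/-- Unique continuation on `X` for a class `Sol` of solutions: a solution on a domain `U ⊆ X` that
vanishes on a non-empty open subset `O` of `U` vanishes on `U`. -/
def UniqueContinuation (k : ℕ) (X : Opens (EuclideanSpace ℝ (Fin n)))
    (Sol : ∀ U : Opens (EuclideanSpace ℝ (Fin n)), U ≤ X → (Fin k → 𝓓'(U, ℝ)) → Prop) : Prop :=
  ∀ (U : Opens (EuclideanSpace ℝ (Fin n))) (hU : U ≤ X),
    IsConnected (U : Set (EuclideanSpace ℝ (Fin n))) →
    ∀ u : Fin k → 𝓓'(U, ℝ), Sol U hU u →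
    ∀ O : Opens (EuclideanSpace ℝ (Fin n)), O ≤ U →
      (O : Set (EuclideanSpace ℝ (Fin n))).Nonempty →
      (∀ (j : Fin k) (φ : 𝓓(U, ℝ)), tsupport φ ⊆ (O : Set (EuclideanSpace ℝ (Fin n))) →
        u j φ = 0) →
      u = 0

/-- The unique continuation property of `A` on `X`. -/
def HasUCP : Prop := UniqueContinuation k X A.IsSolution

/-- The unique continuation property of the formal adjoint `A*` on `X`. -/
def AdjointHasUCP : Prop := UniqueContinuation k X A.IsAdjointSolution

end DiffOp

/-! ### Sobolev norms of distributions, with value `∞` outside the Sobolev space -/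

section Norms

variable {n : ℕ} {Ω : Opens (EuclideanSpace ℝ (Fin n))}

/-- `f ∈ L^p(Ω)` and `T` is the distribution `φ ↦ ∫_Ω f φ`. -/
def IsLpRep (p : ℝ) (T : 𝓓'(Ω, ℝ)) (f : EuclideanSpace ℝ (Fin n) → ℝ) : Prop :=
  MemLp f (ENNReal.ofReal p) (volume.restrict (Ω : Set (EuclideanSpace ℝ (Fin n)))) ∧
    ∀ φ : 𝓓(Ω, ℝ), T φ = ∫ x in (Ω : Set (EuclideanSpace ℝ (Fin n))), f x * φ x

/-- The `L^p(Ω)` norm of a distribution: that of the (a.e. unique) function in `L^p(Ω)` representing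
it, and `∞` if there is none. -/
def lpENorm (p : ℝ) (T : 𝓓'(Ω, ℝ)) : ℝ≥0∞ :=
  ⨅ (f : EuclideanSpace ℝ (Fin n) → ℝ) (_ : IsLpRep p T f),
    eLpNorm f (ENNReal.ofReal p) (volume.restrict (Ω : Set (EuclideanSpace ℝ (Fin n))))

/-- The `W^{r,p}(Ω)` norm of a distribution for an order `r ≥ 0`. -/
def posENorm (r : ℕ) (p : ℝ) (T : 𝓓'(Ω, ℝ)) : ℝ≥0∞ :=
  (∑ α ∈ multiIdx n r, lpENorm p (pderiv 𝓓'(Ω, ℝ) α T) ^ p) ^ (1 / p)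

/-- The `W^{r,p}(Ω)` norm of a test function for an order `r ≥ 0`. -/
def testENorm (r : ℕ) (p : ℝ) (φ : 𝓓(Ω, ℝ)) : ℝ≥0∞ :=
  (∑ α ∈ multiIdx n r, eLpNorm (pderiv 𝓓(Ω, ℝ) α φ) (ENNReal.ofReal p)
    (volume.restrict (Ω : Set (EuclideanSpace ℝ (Fin n)))) ^ p) ^ (1 / p)

/-- The `W^{-r,p}(Ω)` norm of a distribution, dual to the norm of `W^{r,p'}_0(Ω)`, `1/p + 1/p' = 1`. -/
def negENorm (r : ℕ) (p : ℝ) (T : 𝓓'(Ω, ℝ)) : ℝ≥0∞ :=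
  ⨆ (φ : 𝓓(Ω, ℝ)) (_ : testENorm r p.conjExponent φ ≤ 1), ‖T φ‖ₑ

/-- The `W^{s,p}(Ω)` norm of a distribution for an integer `s`. -/
def sobENorm : ℤ → ℝ → 𝓓'(Ω, ℝ) → ℝ≥0∞
  | .ofNat r => posENorm r
  | .negSucc r => negENorm (r + 1)

/-- The `[W^{s,p}(Ω)]^k` norm of a vector of distributions. -/
def vecENorm {k : ℕ} (s : ℤ) (p : ℝ) (u : Fin k → 𝓓'(Ω, ℝ)) : ℝ≥0∞ :=
  (∑ j, sobENorm s p (u j) ^ p) ^ (1 / p)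

/-! These are norms: subadditivity, homogeneity, definiteness. -/

theorem lpENorm_add {p : ℝ} (hp : 1 < p) (T S : 𝓓'(Ω, ℝ)) :
    lpENorm p (T + S) ≤ lpENorm p T + lpENorm p S := by
  have hp1 : (1 : ℝ≥0∞) ≤ ENNReal.ofReal p := by
    simpa using ENNReal.ofReal_le_ofReal hp.le
  have key : ∀ f g, IsLpRep p T f → IsLpRep p S g → lpENorm p (T + S) ≤
      eLpNorm f (ENNReal.ofReal p) (volume.restrict (Ω : Set (EuclideanSpace ℝ (Fin n)))) +
      eLpNorm g (ENNReal.ofReal p) (volume.restrict (Ω : Set (EuclideanSpace ℝ (Fin n)))) := by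
    intro f g hf hg
    have hrep : IsLpRep p (T + S) (f + g) := by
      refine ⟨hf.1.add hg.1, fun φ => ?_⟩
      have hint : ∀ h, MemLp h (ENNReal.ofReal p)
          (volume.restrict (Ω : Set (EuclideanSpace ℝ (Fin n)))) →
          Integrable (fun x => h x * φ x)
            (volume.restrict (Ω : Set (EuclideanSpace ℝ (Fin n)))) := by
        intro h hh
        have hl : LocallyIntegrableOn h Ω
            (volume.restrict (Ω : Set (EuclideanSpace ℝ (Fin n)))) :=
          (hh.locallyIntegrable hp1).locallyIntegrableOn _
        simpa [mul_comm] using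
          TestFunction.integrable_bilin (ContinuousLinearMap.mul ℝ ℝ) hl φ
      have : (T + S) φ = T φ + S φ := rfl
      rw [this, hf.2, hg.2, ← integral_add (hint f hf.1) (hint g hg.1)]
      simp [add_mul]
    exact (iInf₂_le _ hrep).trans (eLpNorm_add_le hf.1.1 hg.1.1 hp1)
  rw [lpENorm, lpENorm, lpENorm] at *
  simp only [ENNReal.iInf_add, ENNReal.add_iInf]
  refine le_iInf fun f => le_iInf fun hf => le_iInf fun g => le_iInf fun hg => key _ _ ?_ ?_
  all_goals assumption

theorem lpENorm_smul {p : ℝ} (c : ℝ) (hc : c ≠ 0) (T : 𝓓'(Ω, ℝ)) :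
    lpENorm p (c • T) ≤ ‖c‖ₑ * lpENorm p T := by
  rw [lpENorm, lpENorm, ENNReal.mul_iInf_of_ne (by simpa using hc) (by simp)]
  refine le_iInf fun f => ?_
  rw [ENNReal.mul_iInf_of_ne (by simpa using hc) (by simp)]
  refine le_iInf fun hf => ?_
  rw [← eLpNorm_const_smul]
  refine iInf₂_le (c • f) ⟨hf.1.const_smul c, fun φ => ?_⟩
  have : (c • T) φ = c * T φ := rfl
  rw [this, hf.2, ← integral_const_mul]
  simp [mul_assoc]

theorem lpENorm_zero (p : ℝ) : lpENorm p (0 : 𝓓'(Ω, ℝ)) = 0 := by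
  refine le_antisymm ((iInf₂_le 0 ⟨MemLp.zero, fun φ => ?_⟩).trans (by simp)) zero_le
  have : (0 : 𝓓'(Ω, ℝ)) φ = 0 := rfl
  simp [this]

theorem eLpNorm_test_ne_top (q : ℝ≥0∞) (φ : 𝓓(Ω, ℝ)) :
    eLpNorm φ q (volume.restrict (Ω : Set (EuclideanSpace ℝ (Fin n)))) ≠ ⊤ :=
  ((φ.continuous.memLp_of_hasCompactSupport φ.hasCompactSupport).restrict _).2.ne

theorem eq_zero_of_lpENorm_eq_zero {p : ℝ} (hp : 1 < p) (T : 𝓓'(Ω, ℝ))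
    (hT : lpENorm p T = 0) : T = 0 := by
  ext φ
  have hpq : ENNReal.HolderConjugate (ENNReal.ofReal p) (ENNReal.ofReal p.conjExponent) :=
    (Real.HolderConjugate.conjExponent hp).ennrealOfReal
  set C := eLpNorm φ (ENNReal.ofReal p.conjExponent)
    (volume.restrict (Ω : Set (EuclideanSpace ℝ (Fin n)))) with hC
  have hCt : C ≠ ⊤ := eLpNorm_test_ne_top _ φ
  have key : ‖T φ‖ₑ ≤ lpENorm p T * (C + 1) := by
    rw [lpENorm, ENNReal.iInf_mul_of_ne (by simp) (by simp [hCt])]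
    refine le_iInf fun f => ?_
    rw [ENNReal.iInf_mul_of_ne (by simp) (by simp [hCt])]
    refine le_iInf fun hf => ?_
    have h1 : ‖T φ‖ₑ ≤ eLpNorm (f • (φ : EuclideanSpace ℝ (Fin n) → ℝ)) 1
        (volume.restrict (Ω : Set (EuclideanSpace ℝ (Fin n)))) := by
      rw [hf.2, eLpNorm_one_eq_lintegral_enorm]
      exact enorm_integral_le_lintegral_enorm _
    refine h1.trans ((eLpNorm_smul_le_mul_eLpNorm (p := ENNReal.ofReal p)
      (q := ENNReal.ofReal p.conjExponent) φ.aestronglyMeasurable hf.1.1).trans ?_)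
    gcongr
    exact le_self_add
  have : ‖T φ‖ₑ = 0 := by simpa [hT] using key
  simpa using this

theorem posENorm_add {p : ℝ} (hp : 1 < p) (r : ℕ) (T S : 𝓓'(Ω, ℝ)) :
    posENorm r p (T + S) ≤ posENorm r p T + posENorm r p S := by
  have hp0 : 0 < p := by linarith
  refine le_trans ?_ (ENNReal.Lp_add_le _ _ _ hp.le)
  unfold posENorm
  gcongr with α hα
  rw [map_add]
  exact lpENorm_add hp _ _

theorem posENorm_smul {p : ℝ} (hp : 1 < p) (r : ℕ) (c : ℝ) (hc : c ≠ 0) (T : 𝓓'(Ω, ℝ)) :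
    posENorm r p (c • T) ≤ ‖c‖ₑ * posENorm r p T := by
  have hp0 : 0 < p := by linarith
  have h : ‖c‖ₑ = (‖c‖ₑ ^ p) ^ (1 / p) := by
    rw [← ENNReal.rpow_mul, mul_one_div_cancel hp0.ne', ENNReal.rpow_one]
  unfold posENorm
  rw [h, ← ENNReal.mul_rpow_of_nonneg _ _ (by positivity), Finset.mul_sum]
  gcongr with α hα
  rw [map_smul, ← ENNReal.mul_rpow_of_nonneg _ _ hp0.le]
  gcongr
  exact lpENorm_smul c hc _

theorem eq_zero_of_posENorm_eq_zero {p : ℝ} (hp : 1 < p) (r : ℕ) (T : 𝓓'(Ω, ℝ))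
    (hT : posENorm r p T = 0) : T = 0 := by
  have hp0 : 0 < p := by linarith
  have h0 : ∑ α ∈ multiIdx n r, lpENorm p (pderiv 𝓓'(Ω, ℝ) α T) ^ p = 0 :=
    (ENNReal.rpow_eq_zero_iff_of_pos (by positivity)).1 hT
  have h1 := (Finset.sum_eq_zero_iff.1 h0) 0 (mem_multiIdx.2 (by simp))
  rw [pderiv_zero] at h1
  exact eq_zero_of_lpENorm_eq_zero hp T ((ENNReal.rpow_eq_zero_iff_of_pos hp0).1 h1)

theorem posENorm_zero {p : ℝ} (hp : 1 < p) (r : ℕ) : posENorm r p (0 : 𝓓'(Ω, ℝ)) = 0 := by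
  have hp0 : 0 < p := by linarith
  simp [posENorm, lpENorm_zero, hp0]

theorem testENorm_smul {p : ℝ} (hp : 1 < p) (r : ℕ) (c : ℝ) (φ : 𝓓(Ω, ℝ)) :
    testENorm r p (c • φ) = ‖c‖ₑ * testENorm r p φ := by
  have hp0 : 0 < p := by linarith
  have h : ‖c‖ₑ = (‖c‖ₑ ^ p) ^ (1 / p) := by
    rw [← ENNReal.rpow_mul, mul_one_div_cancel hp0.ne', ENNReal.rpow_one]
  unfold testENorm
  rw [h, ← ENNReal.mul_rpow_of_nonneg _ _ (by positivity), Finset.mul_sum]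
  congr 1
  refine Finset.sum_congr rfl fun α _ => ?_
  rw [map_smul, ← ENNReal.mul_rpow_of_nonneg _ _ hp0.le, ← eLpNorm_const_smul]
  rfl

theorem testENorm_ne_top {p : ℝ} (hp : 1 < p) (r : ℕ) (φ : 𝓓(Ω, ℝ)) :
    testENorm r p φ ≠ ⊤ := by
  have hp0 : 0 < p := by linarith
  refine ENNReal.rpow_ne_top_of_nonneg (by positivity) (ENNReal.sum_ne_top.2 fun α _ => ?_)
  exact ENNReal.rpow_ne_top_of_nonneg hp0.le (eLpNorm_test_ne_top _ _)

theorem negENorm_add {p : ℝ} (r : ℕ) (T S : 𝓓'(Ω, ℝ)) :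
    negENorm r p (T + S) ≤ negENorm r p T + negENorm r p S := by
  refine iSup₂_le fun φ hφ => ?_
  have : (T + S) φ = T φ + S φ := rfl
  rw [this]
  exact (enorm_add_le _ _).trans (add_le_add
    (le_iSup₂ (f := fun (φ : 𝓓(Ω, ℝ)) (_ : testENorm r p.conjExponent φ ≤ 1) => ‖T φ‖ₑ) φ hφ)
    (le_iSup₂ (f := fun (φ : 𝓓(Ω, ℝ)) (_ : testENorm r p.conjExponent φ ≤ 1) => ‖S φ‖ₑ) φ hφ))

theorem negENorm_smul {p : ℝ} (r : ℕ) (c : ℝ) (T : 𝓓'(Ω, ℝ)) :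
    negENorm r p (c • T) ≤ ‖c‖ₑ * negENorm r p T := by
  refine iSup₂_le fun φ hφ => ?_
  have : (c • T) φ = c * T φ := rfl
  rw [this, enorm_mul]
  gcongr
  exact le_iSup₂ (f := fun (φ : 𝓓(Ω, ℝ)) (_ : testENorm r p.conjExponent φ ≤ 1) => ‖T φ‖ₑ) φ hφ

theorem negENorm_zero (p : ℝ) (r : ℕ) : negENorm r p (0 : 𝓓'(Ω, ℝ)) = 0 := by
  refine le_antisymm (iSup₂_le fun φ _ => ?_) zero_le
  have : (0 : 𝓓'(Ω, ℝ)) φ = 0 := rfl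
  simp [this]

theorem eq_zero_of_negENorm_eq_zero {p : ℝ} (hp : 1 < p) (r : ℕ) (T : 𝓓'(Ω, ℝ))
    (hT : negENorm r p T = 0) : T = 0 := by
  ext φ
  have hq : 1 < p.conjExponent := (Real.HolderConjugate.conjExponent hp).symm.lt
  have ht := testENorm_ne_top hq r φ
  set t := testENorm r p.conjExponent φ with htdef
  have hc : (0 : ℝ) < (t.toReal + 1)⁻¹ := by positivity
  have hle : testENorm r p.conjExponent ((t.toReal + 1)⁻¹ • φ) ≤ 1 := by
    rw [testENorm_smul hq, ← htdef, Real.enorm_of_nonneg hc.le, ← ENNReal.ofReal_toReal ht,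
      ENNReal.toReal_ofReal ENNReal.toReal_nonneg, ← ENNReal.ofReal_mul hc.le,
      ENNReal.ofReal_le_one, inv_mul_le_one₀ (by positivity)]
    linarith
  have h := (le_iSup₂ (f := fun (φ : 𝓓(Ω, ℝ)) (_ : testENorm r p.conjExponent φ ≤ 1) => ‖T φ‖ₑ)
    _ hle).trans_eq hT
  rw [map_smul] at h
  have h2 : (t.toReal + 1)⁻¹ • T φ = 0 := by simpa only [nonpos_iff_eq_zero, enorm_eq_zero] using h
  exact (smul_eq_zero.1 h2).resolve_left hc.ne'

theorem sobENorm_add {p : ℝ} (hp : 1 < p) (s : ℤ) (T S : 𝓓'(Ω, ℝ)) :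
    sobENorm s p (T + S) ≤ sobENorm s p T + sobENorm s p S := by
  cases s with
  | ofNat r => exact posENorm_add hp r T S
  | negSucc r => exact negENorm_add _ T S

theorem sobENorm_zero {p : ℝ} (hp : 1 < p) (s : ℤ) : sobENorm s p (0 : 𝓓'(Ω, ℝ)) = 0 := by
  cases s with
  | ofNat r => exact posENorm_zero hp r
  | negSucc r => exact negENorm_zero p _

theorem sobENorm_smul {p : ℝ} (hp : 1 < p) (s : ℤ) (c : ℝ) (T : 𝓓'(Ω, ℝ)) :
    sobENorm s p (c • T) ≤ ‖c‖ₑ * sobENorm s p T := by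
  rcases eq_or_ne c 0 with rfl | hc
  · simp [sobENorm_zero hp]
  cases s with
  | ofNat r => exact posENorm_smul hp r c hc T
  | negSucc r => exact negENorm_smul _ c T

theorem eq_zero_of_sobENorm_eq_zero {p : ℝ} (hp : 1 < p) (s : ℤ) (T : 𝓓'(Ω, ℝ))
    (hT : sobENorm s p T = 0) : T = 0 := by
  cases s with
  | ofNat r => exact eq_zero_of_posENorm_eq_zero hp r T hT
  | negSucc r => exact eq_zero_of_negENorm_eq_zero hp _ T hT

theorem vecENorm_add {k : ℕ} {p : ℝ} (hp : 1 < p) (s : ℤ) (u v : Fin k → 𝓓'(Ω, ℝ)) :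
    vecENorm s p (u + v) ≤ vecENorm s p u + vecENorm s p v := by
  have hp0 : 0 < p := by linarith
  refine le_trans ?_ (ENNReal.Lp_add_le _ _ _ hp.le)
  unfold vecENorm
  gcongr with j hj
  exact sobENorm_add hp s _ _

theorem vecENorm_smul {k : ℕ} {p : ℝ} (hp : 1 < p) (s : ℤ) (c : ℝ) (u : Fin k → 𝓓'(Ω, ℝ)) :
    vecENorm s p (c • u) ≤ ‖c‖ₑ * vecENorm s p u := by
  have hp0 : 0 < p := by linarith
  have h : ‖c‖ₑ = (‖c‖ₑ ^ p) ^ (1 / p) := by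
    rw [← ENNReal.rpow_mul, mul_one_div_cancel hp0.ne', ENNReal.rpow_one]
  unfold vecENorm
  rw [h, ← ENNReal.mul_rpow_of_nonneg _ _ (by positivity), Finset.mul_sum]
  gcongr with j hj
  rw [← ENNReal.mul_rpow_of_nonneg _ _ hp0.le]
  gcongr
  exact sobENorm_smul hp s c _

theorem vecENorm_zero {k : ℕ} {p : ℝ} (hp : 1 < p) (s : ℤ) :
    vecENorm s p (0 : Fin k → 𝓓'(Ω, ℝ)) = 0 := by
  have hp0 : 0 < p := by linarith
  simp [vecENorm, sobENorm_zero hp, hp0]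

theorem eq_zero_of_vecENorm_eq_zero {k : ℕ} {p : ℝ} (hp : 1 < p) (s : ℤ)
    (u : Fin k → 𝓓'(Ω, ℝ)) (hu : vecENorm s p u = 0) : u = 0 := by
  have hp0 : 0 < p := by linarith
  have h0 : ∑ j, sobENorm s p (u j) ^ p = 0 :=
    (ENNReal.rpow_eq_zero_iff_of_pos (by positivity)).1 hu
  funext j
  have h1 := (Finset.sum_eq_zero_iff.1 h0) j (Finset.mem_univ j)
  exact eq_zero_of_sobENorm_eq_zero hp s _ ((ENNReal.rpow_eq_zero_iff_of_pos hp0).1 h1)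

end Norms

/-! ### The Banach space `S_A^{s,p}(D)` of Sobolev solutions -/

section Space

variable {n k m : ℕ} {X : Opens (EuclideanSpace ℝ (Fin n))}

/-- The vectors `u ∈ [W^{s,p}(D)]^k` with `A u = 0` in `D`, as a space of vector distributions. -/
def solSubmodule (A : DiffOp n k m X) (D : Opens (EuclideanSpace ℝ (Fin n))) (hD : D ≤ X)
    (s : ℤ) (p : ℝ) (hp : 1 < p) : Submodule ℝ (Fin k → 𝓓'(D, ℝ)) where
  carrier := {u | A.IsSolution D hD u ∧ vecENorm s p u < ⊤}
  zero_mem' := by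
    refine ⟨fun i φ => ?_, by simp [vecENorm_zero hp]⟩
    simp
  add_mem' := by
    rintro u v ⟨hu, hu'⟩ ⟨hv, hv'⟩
    refine ⟨fun i φ => ?_, (vecENorm_add hp s u v).trans_lt (ENNReal.add_lt_top.2 ⟨hu', hv'⟩)⟩
    have h := congrArg₂ (· + ·) (hu i φ) (hv i φ)
    simp only [← Finset.sum_add_distrib, add_zero] at h
    simpa [map_add] using h
  smul_mem' := by
    rintro c u ⟨hu, hu'⟩
    refine ⟨fun i φ => ?_, (vecENorm_smul hp s c u).trans_lt
      (ENNReal.mul_lt_top enorm_lt_top hu')⟩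
    have h := congrArg (c * ·) (hu i φ)
    simp only [Finset.mul_sum, mul_zero] at h
    simpa [map_smul] using h

/-- The space `S_A^{s,p}(D)`, normed by `[W^{s,p}(D)]^k`. -/
def SobolevSol (A : DiffOp n k m X) (D : Opens (EuclideanSpace ℝ (Fin n))) (hD : D ≤ X)
    (s : ℤ) (p : ℝ) (hp : 1 < p) : Type :=
  solSubmodule A D hD s p hp

variable (A : DiffOp n k m X) (D : Opens (EuclideanSpace ℝ (Fin n))) (hD : D ≤ X)
    (s : ℤ) (p : ℝ) (hp : 1 < p)

/-- The underlying vector distribution. -/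
def SobolevSol.toDistr {A : DiffOp n k m X} {D : Opens (EuclideanSpace ℝ (Fin n))} {hD : D ≤ X}
    {s : ℤ} {p : ℝ} {hp : 1 < p} (u : SobolevSol A D hD s p hp) : Fin k → 𝓓'(D, ℝ) :=
  Subtype.val u

instance SobolevSol.instAddCommGroup : AddCommGroup (SobolevSol A D hD s p hp) :=
  inferInstanceAs (AddCommGroup (solSubmodule A D hD s p hp))

instance SobolevSol.instModule : Module ℝ (SobolevSol A D hD s p hp) :=
  inferInstanceAs (Module ℝ (solSubmodule A D hD s p hp))

theorem SobolevSol.norm_smul_aux (c : ℝ) (u : SobolevSol A D hD s p hp) :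
    (vecENorm s p (c • u).toDistr).toReal ≤ ‖c‖ * (vecENorm s p u.toDistr).toReal := by
  have h := ENNReal.toReal_mono (ENNReal.mul_ne_top enorm_ne_top u.2.2.ne)
    (vecENorm_smul hp s c u.toDistr)
  rwa [ENNReal.toReal_mul, toReal_enorm] at h

instance SobolevSol.instNormedAddCommGroup : NormedAddCommGroup (SobolevSol A D hD s p hp) :=
  AddGroupNorm.toNormedAddCommGroup
    { toFun := fun u => (vecENorm s p u.toDistr).toReal
      map_zero' := by
        have : (0 : SobolevSol A D hD s p hp).toDistr = 0 := rfl
        rw [this, vecENorm_zero hp]; rfl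
      add_le' := fun u v => by
        have hu : vecENorm s p u.toDistr ≠ ⊤ := u.2.2.ne
        have hv : vecENorm s p v.toDistr ≠ ⊤ := v.2.2.ne
        rw [← ENNReal.toReal_add hu hv]
        exact ENNReal.toReal_mono (ENNReal.add_ne_top.2 ⟨hu, hv⟩)
          (vecENorm_add hp s u.toDistr v.toDistr)
      neg' := fun u => by
        have h : ∀ v : SobolevSol A D hD s p hp,
            (vecENorm s p (-v).toDistr).toReal ≤ (vecENorm s p v.toDistr).toReal := fun v => by
          simpa using SobolevSol.norm_smul_aux A D hD s p hp (-1) v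
        exact le_antisymm (h u) (by simpa using h (-u))
      eq_zero_of_map_eq_zero' := fun u hu => Subtype.ext
        (eq_zero_of_vecENorm_eq_zero hp s _
          (((ENNReal.toReal_eq_zero_iff _).1 hu).resolve_right u.2.2.ne)) }

theorem SobolevSol.norm_def (u : SobolevSol A D hD s p hp) :
    ‖u‖ = (vecENorm s p u.toDistr).toReal := rfl

instance SobolevSol.instNormedSpace : NormedSpace ℝ (SobolevSol A D hD s p hp) where
  norm_smul_le := SobolevSol.norm_smul_aux A D hD s p hp

end Space

/-! ### Domains, convex functionals, the minimization problem -/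

/-- An open set with `C^∞` boundary: near each boundary point it is `{ρ < 0}` for a smooth `ρ` with
non-vanishing differential. -/
def HasSmoothBoundary {n : ℕ} (D : Opens (EuclideanSpace ℝ (Fin n))) : Prop :=
  ∀ x ∈ frontier (D : Set (EuclideanSpace ℝ (Fin n))),
    ∃ (U : Set (EuclideanSpace ℝ (Fin n))) (ρ : EuclideanSpace ℝ (Fin n) → ℝ),
      IsOpen U ∧ x ∈ U ∧ ContDiffOn ℝ ∞ ρ U ∧ fderiv ℝ ρ x ≠ 0 ∧
        (D : Set (EuclideanSpace ℝ (Fin n))) ∩ U = {y ∈ U | ρ y < 0}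

/-- `K` has no compact connected component. -/
def NoCompactComponents {n : ℕ} (K : Set (EuclideanSpace ℝ (Fin n))) : Prop :=
  ∀ x ∈ K, ¬ IsCompact (connectedComponentIn K x)

section Convex

variable {V : Type*} [AddCommGroup V] [Module ℝ V]

/-- `F` takes values in `(-∞, +∞]` and is not identically `+∞`. -/
def IsProper (F : V → EReal) : Prop := (∀ x, F x ≠ ⊥) ∧ ∃ x, F x ≠ ⊤

/-- Convexity of an extended real valued functional. -/
def IsConvexFun (F : V → EReal) : Prop :=
  ∀ (x y : V) (a b : ℝ), 0 < a → 0 < b → a + b = 1 →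
    F (a • x + b • y) ≤ (a : EReal) * F x + (b : EReal) * F y

/-- Strict convexity of an extended real valued functional (on its effective domain). -/
def IsStrictConvexFun (F : V → EReal) : Prop :=
  ∀ (x y : V) (a b : ℝ), x ≠ y → F x ≠ ⊤ → F y ≠ ⊤ → 0 < a → 0 < b → a + b = 1 →
    F (a • x + b • y) < (a : EReal) * F x + (b : EReal) * F y

/-- `F(x) → +∞` as `|x| → ∞`. -/
def IsCoerciveFun {W : Type*} [NormedAddCommGroup W] (F : W → EReal) : Prop :=
  Tendsto F (Bornology.cobounded W) (𝓝 ⊤)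

end Convex

/-- The functional `u ↦ F(M u) + b ‖u‖`. -/
def objective {V W : Type*} [NormedAddCommGroup V] [NormedSpace ℝ V] [NormedAddCommGroup W]
    [NormedSpace ℝ W] (F : W → EReal) (M : V →L[ℝ] W) (b : ℝ) (u : V) : EReal :=
  F (M u) + ((b * ‖u‖ : ℝ) : EReal)


end SobSol

end

/-!
The functional is minimized by a soft argument: all that is used about `S_A^{s,p}(D)` is that it is
a uniformly convex Banach space and that `M` is onto a finite-dimensional space.

Existence. In a uniformly convex Banach space every fibre of `M` has an element of minimal norm,
because minimizing sequences for the norm are Cauchy (`PUniformlyConvex.exists_isMinOn_norm`). The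
minimal norm `G x` over the fibre of `x` is Lipschitz in `x`, as `M` has a bounded right inverse.
The problem thus reduces to minimizing `F + b G` on a finite-dimensional space, where lower
semicontinuity and coercivity suffice (`PUniformlyConvex.exists_isMinOn_objective`). No weak
compactness is needed.

Uniqueness. Strict convexity of `F` forces two minimizers into the same fibre of `M`; there they
have equal norms and strict convexity of the norm applies
(`PUniformlyConvex.eq_of_isMinOn_objective`).

Uniform convexity. It is phrased as an inequality between `p`-th powers (`PUniformlyConvex`) which
integrates and sums, so that for `s ≥ 0` it follows from a scalar inequality for `|x|^p`. For
`s < 0` the norm is dual to a norm on test functions built from `L^{p'}` norms. The latter is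
uniformly smooth, again by a scalar inequality, and the dual of a uniformly smooth norm is uniformly
convex (`dual_uniformConvex`).

Completeness (`SobolevSol.completeSpace`). For `s ≥ 0` it comes from completeness of `L^p`. For
`s < 0` the pointwise limit of a Cauchy sequence is a distribution because the norm of test
functions is continuous on them, `D` having finite measure. In both cases norm convergence implies
pointwise convergence on test functions, under which the equation `A u = 0` is closed.
-/

namespace SobSol

/-! ### Scalar inequalities for `|x|^p` -/

theorem midpoint_abs_rpow_lt {p : ℝ} (hp : 1 < p) {a b : ℝ} (hab : a ≠ b) :
    |2⁻¹ * (a + b)| ^ p < (|a| ^ p + |b| ^ p) / 2 := by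
  have hp0 : 0 < p := by linarith
  rcases eq_or_ne |a| |b| with h | h
  · obtain rfl : a = -b := (abs_eq_abs.1 h).resolve_left hab
    have hb : b ≠ 0 := by
      rintro rfl
      simp at hab
    have : 0 < |b| ^ p := Real.rpow_pos_of_pos (abs_pos.2 hb) p
    simpa [Real.zero_rpow hp0.ne'] using this
  · have h1 : |2⁻¹ * (a + b)| ≤ 2⁻¹ * |a| + 2⁻¹ * |b| := by
      rw [abs_mul, abs_of_pos (by norm_num : (0 : ℝ) < 2⁻¹), ← mul_add]
      gcongr
      exact abs_add_le a b
    have h2 := (strictConvexOn_rpow hp).2 (abs_nonneg a) (abs_nonneg b) h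
      (by norm_num : (0 : ℝ) < 2⁻¹) (by norm_num : (0 : ℝ) < 2⁻¹) (by norm_num)
    simp only [smul_eq_mul] at h2
    calc |2⁻¹ * (a + b)| ^ p ≤ (2⁻¹ * |a| + 2⁻¹ * |b|) ^ p :=
          Real.rpow_le_rpow (abs_nonneg _) h1 hp0.le
      _ < 2⁻¹ * |a| ^ p + 2⁻¹ * |b| ^ p := h2
      _ = (|a| ^ p + |b| ^ p) / 2 := by ring

theorem norm_rpow_le_abs_rpow_add (p : ℝ) (z : ℝ × ℝ) :
    ‖z‖ ^ p ≤ |z.1| ^ p + |z.2| ^ p := by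
  rw [Prod.norm_def, Real.norm_eq_abs, Real.norm_eq_abs]
  rcases max_choice |z.1| |z.2| with h | h <;> rw [h]
  · exact le_add_of_nonneg_right (by positivity)
  · exact le_add_of_nonneg_left (by positivity)

/-- Quantitative strict convexity of `|x|^p`. Both sides are homogeneous in `(a, b)`, so only the
unit sphere matters, where the convexity defect is bounded below as long as
`|a - b|^p ≥ ε (|a|^p + |b|^p)`. -/
theorem exists_abs_rpow_uniformConvex {p : ℝ} (hp : 1 < p) {ε : ℝ} (hε : 0 < ε) :
    ∃ C : ℝ, 0 ≤ C ∧ ∀ a b : ℝ, |a - b| ^ p + C * |2⁻¹ * (a + b)| ^ p ≤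
      (ε + C / 2) * (|a| ^ p + |b| ^ p) := by
  have hp0 : 0 < p := by linarith
  set K : Set (ℝ × ℝ) := Metric.sphere 0 1 ∩ {z | ε * (|z.1| ^ p + |z.2| ^ p) ≤ |z.1 - z.2| ^ p}
    with hK
  have hc : ∀ f : ℝ × ℝ → ℝ, Continuous f → Continuous fun z => |f z| ^ p := fun f hf =>
    hf.abs.rpow_const fun _ => Or.inr hp0.le
  have hKc : IsCompact K := by
    refine (isCompact_sphere _ _).inter_right (isClosed_le ?_ ?_)
    · exact continuous_const.mul ((hc _ continuous_fst).add (hc _ continuous_snd))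
    · exact hc _ (continuous_fst.sub continuous_snd)
  obtain ⟨δ, hδ, hδK⟩ : ∃ δ : ℝ, 0 < δ ∧ ∀ z ∈ K,
      δ ≤ (|z.1| ^ p + |z.2| ^ p) / 2 - |2⁻¹ * (z.1 + z.2)| ^ p := by
    rcases K.eq_empty_or_nonempty with h | h
    · exact ⟨1, one_pos, by simp [h]⟩
    · have hcont : Continuous fun z : ℝ × ℝ =>
          (|z.1| ^ p + |z.2| ^ p) / 2 - |2⁻¹ * (z.1 + z.2)| ^ p :=
        (((hc _ continuous_fst).add (hc _ continuous_snd)).div_const 2).sub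
          (hc _ (continuous_const.mul (continuous_fst.add continuous_snd)))
      obtain ⟨z₀, hz₀, hmin⟩ := hKc.exists_isMinOn h hcont.continuousOn
      refine ⟨_, ?_, fun z hz => hmin hz⟩
      refine sub_pos.2 (midpoint_abs_rpow_lt hp fun heq => ?_)
      have h1 : (1 : ℝ) ≤ |z₀.1| ^ p + |z₀.2| ^ p := by
        simpa [mem_sphere_zero_iff_norm.1 hz₀.1] using norm_rpow_le_abs_rpow_add p z₀
      have h2 := hz₀.2
      simp only [mem_ofPred_eq, heq, sub_self, abs_zero, Real.zero_rpow hp0.ne'] at h2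
      rw [heq] at h1
      nlinarith
  have hmid : ∀ a b : ℝ, |2⁻¹ * (a + b)| ^ p ≤ (|a| ^ p + |b| ^ p) / 2 := fun a b => by
    rcases eq_or_ne a b with rfl | h
    · rw [show 2⁻¹ * (a + a) = a by ring]; linarith
    · exact (midpoint_abs_rpow_lt hp h).le
  have h2p : (0 : ℝ) ≤ 2 ^ p := by positivity
  refine ⟨2 ^ p / δ, by positivity, ?_⟩
  have hsphere : ∀ z : ℝ × ℝ, ‖z‖ = 1 → |z.1 - z.2| ^ p + 2 ^ p / δ * |2⁻¹ * (z.1 + z.2)| ^ p ≤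
      (ε + 2 ^ p / δ / 2) * (|z.1| ^ p + |z.2| ^ p) := by
    intro z hz
    by_cases hzK : z ∈ K
    · have h1 : |z.1 - z.2| ^ p ≤ 2 ^ p := by
        refine Real.rpow_le_rpow (abs_nonneg _) ?_ hp0.le
        have := norm_fst_le z
        have := norm_snd_le z
        simp only [Real.norm_eq_abs] at *
        exact (abs_sub _ _).trans (by linarith)
      have h2 := mul_le_mul_of_nonneg_left (hδK z hzK) (by positivity : 0 ≤ 2 ^ p / δ)
      rw [div_mul_cancel₀ _ hδ.ne'] at h2
      have h3 : 0 ≤ ε * (|z.1| ^ p + |z.2| ^ p) := by positivity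
      nlinarith
    · have h1 : |z.1 - z.2| ^ p ≤ ε * (|z.1| ^ p + |z.2| ^ p) := by
        by_contra h
        exact hzK ⟨mem_sphere_zero_iff_norm.2 hz, (not_le.1 h).le⟩
      have h2 := mul_le_mul_of_nonneg_left (hmid z.1 z.2) (by positivity : 0 ≤ 2 ^ p / δ)
      nlinarith
  intro a b
  rcases eq_or_ne ((a, b) : ℝ × ℝ) 0 with h | h
  · obtain ⟨rfl, rfl⟩ := Prod.mk_eq_zero.1 h
    simp [Real.zero_rpow hp0.ne']
  · have hr : 0 < ‖((a, b) : ℝ × ℝ)‖ := norm_pos_iff.2 h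
    set r := ‖((a, b) : ℝ × ℝ)‖
    have h1 := hsphere (r⁻¹ • (a, b)) (by
      rw [norm_smul, norm_inv, Real.norm_of_nonneg hr.le, inv_mul_cancel₀ hr.ne'])
    have hs : ∀ x : ℝ, |r⁻¹ * x| ^ p = (r⁻¹) ^ p * |x| ^ p := fun x => by
      rw [abs_mul, abs_of_pos (inv_pos.2 hr), Real.mul_rpow (by positivity) (abs_nonneg x)]
    simp only [Prod.smul_mk, smul_eq_mul] at h1
    rw [← mul_sub, ← mul_add, mul_left_comm, hs, hs, hs, hs] at h1
    have hrp : 0 < (r⁻¹) ^ p := Real.rpow_pos_of_pos (inv_pos.2 hr) p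
    refine le_of_mul_le_mul_left ?_ hrp
    linarith

/-- Quantitative smoothness of `|x|^q`: it is `C¹`, so its second symmetric differences are `o(t)`,
uniformly on the unit sphere and hence, by homogeneity, everywhere. -/
theorem exists_abs_rpow_uniformSmooth {q : ℝ} (hq : 1 < q) {ε : ℝ} (hε : 0 < ε) :
    ∃ t : ℝ, 0 < t ∧ ∀ a b : ℝ, |a + t * b| ^ q + |a - t * b| ^ q ≤
      2 * |a| ^ q + ε * t * (|a| ^ q + |b| ^ q) := by
  have hq0 : 0 < q := by linarith
  have hC : ContDiff ℝ 1 fun x : ℝ => |x| ^ q := contDiff_norm_rpow hq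
  set φ : ℝ → ℝ := fun x => |x| ^ q with hφ
  have hd : Differentiable ℝ φ := hC.differentiable one_ne_zero
  have hdc : Continuous (deriv φ) := hC.continuous_deriv le_rfl
  have huc := (isCompact_Icc (a := (-2 : ℝ)) (b := 2)).uniformContinuousOn_of_continuous
    hdc.continuousOn
  obtain ⟨δ, hδ, hδ'⟩ := Metric.uniformContinuousOn_iff.1 huc ε hε
  set t := min 1 (δ / 3) with ht
  have ht0 : 0 < t := by positivity
  have ht1 : t ≤ 1 := min_le_left _ _
  have htδ : 2 * t < δ := by
    have : t ≤ δ / 3 := min_le_right _ _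
    linarith
  refine ⟨t, ht0, ?_⟩
  have hsphere : ∀ z : ℝ × ℝ, ‖z‖ = 1 → |z.1 + t * z.2| ^ q + |z.1 - t * z.2| ^ q ≤
      2 * |z.1| ^ q + ε * t * (|z.1| ^ q + |z.2| ^ q) := by
    rintro ⟨a, b⟩ hz
    have ha : |a| ≤ 1 := hz ▸ norm_fst_le ((a, b) : ℝ × ℝ)
    have hb : |b| ≤ 1 := hz ▸ norm_snd_le ((a, b) : ℝ × ℝ)
    have hsum : 1 ≤ |a| ^ q + |b| ^ q := by
      simpa [hz] using norm_rpow_le_abs_rpow_add q (a, b)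
    have hderiv : ∀ h ∈ Icc (-t) t, HasDerivWithinAt (fun h => φ (a + h) + φ (a - h))
        (deriv φ (a + h) - deriv φ (a - h)) (Icc (-t) t) h := by
      intro h _
      have h1 : HasDerivAt (fun h => φ (a + h)) (deriv φ (a + h)) h :=
        (hd (a + h)).hasDerivAt.comp_const_add a h
      have h2 : HasDerivAt (fun h => φ (a - h)) (-deriv φ (a - h)) h :=
        (hd (a - h)).hasDerivAt.comp_const_sub a h
      exact (h1.add h2).hasDerivWithinAt
    have hbound : ∀ h ∈ Icc (-t) t, ‖deriv φ (a + h) - deriv φ (a - h)‖ ≤ ε := by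
      intro h hh
      have ha' := abs_le.1 ha
      refine (hδ' (a + h) ⟨by linarith [hh.1], by linarith [hh.2]⟩ (a - h)
        ⟨by linarith [hh.2], by linarith [hh.1]⟩ ?_).le
      rw [Real.dist_eq, show a + h - (a - h) = 2 * h by ring, abs_mul, abs_two]
      linarith [abs_le.2 hh]
    have htb : |t * b| ≤ t := by
      rw [abs_mul, abs_of_pos ht0]
      exact mul_le_of_le_one_right ht0.le hb
    have h1 := (convex_Icc (-t) t).norm_image_sub_le_of_norm_hasDerivWithin_le hderiv hbound
      (x := 0) (y := t * b) ⟨by linarith, ht0.le⟩ (abs_le.1 htb)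
    have h2 := (le_abs_self _).trans h1
    simp only [add_zero, sub_zero, hφ, Real.norm_eq_abs] at h2
    have h3 : ε * |t * b| ≤ ε * t * (|a| ^ q + |b| ^ q) := by
      calc ε * |t * b| ≤ ε * t * 1 := by rw [mul_one]; gcongr
        _ ≤ _ := by gcongr
    show |a + t * b| ^ q + |a - t * b| ^ q ≤ 2 * |a| ^ q + ε * t * (|a| ^ q + |b| ^ q)
    linarith
  intro a b
  rcases eq_or_ne ((a, b) : ℝ × ℝ) 0 with h | h
  · obtain ⟨rfl, rfl⟩ := Prod.mk_eq_zero.1 h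
    simp [Real.zero_rpow hq0.ne']
  · have hr : 0 < ‖((a, b) : ℝ × ℝ)‖ := norm_pos_iff.2 h
    set r := ‖((a, b) : ℝ × ℝ)‖
    have h1 := hsphere (r⁻¹ • (a, b)) (by
      rw [norm_smul, norm_inv, Real.norm_of_nonneg hr.le, inv_mul_cancel₀ hr.ne'])
    have hs : ∀ x : ℝ, |r⁻¹ * x| ^ q = (r⁻¹) ^ q * |x| ^ q := fun x => by
      rw [abs_mul, abs_of_pos (inv_pos.2 hr), Real.mul_rpow (by positivity) (abs_nonneg x)]
    simp only [Prod.smul_mk, smul_eq_mul] at h1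
    rw [mul_left_comm t, ← mul_sub, ← mul_add, hs, hs, hs, hs] at h1
    have hrp : 0 < (r⁻¹) ^ q := Real.rpow_pos_of_pos (inv_pos.2 hr) q
    refine le_of_mul_le_mul_left ?_ hrp
    linarith

theorem enorm_rpow_eq_ofReal {p : ℝ} (hp : 0 < p) (x : ℝ) : ‖x‖ₑ ^ p = ENNReal.ofReal (|x| ^ p) := by
  rw [Real.enorm_eq_ofReal_abs, ENNReal.ofReal_rpow_of_nonneg (abs_nonneg x) hp.le]

/-! ### Uniform convexity of the Sobolev norms -/

/-- Uniform convexity of an extended norm, in a form adapted to the exponent `p`: it bounds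
`N (u - v)` by the convexity defect of `N ^ p` at the midpoint, up to an arbitrarily small multiple
of `N u ^ p + N v ^ p`. Since it is additive in the `p`-th powers, it passes to `L^p` norms and to
`ℓ^p` sums. The inequality is written without subtraction, so that it makes sense where `N = ∞`. -/
def PUniformlyConvex {E : Type*} [AddCommGroup E] [Module ℝ E] (p : ℝ) (N : E → ℝ≥0∞) : Prop :=
  ∀ ε : ℝ, 0 < ε → ∃ C : ℝ, 0 ≤ C ∧ ∀ u v : E,
    N (u - v) ^ p + ENNReal.ofReal C * N ((2⁻¹ : ℝ) • (u + v)) ^ p ≤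
      ENNReal.ofReal (ε + C / 2) * (N u ^ p + N v ^ p)

theorem PUniformlyConvex.sum {E ι : Type*} [AddCommGroup E] [Module ℝ E] {p : ℝ}
    {V : Type*} [AddCommGroup V] [Module ℝ V] (hp : 0 < p) {N : E → ℝ≥0∞}
    (hN : PUniformlyConvex p N) (s : Finset ι) (L : ι → V →ₗ[ℝ] E) :
    PUniformlyConvex p fun u => (∑ i ∈ s, N (L i u) ^ p) ^ (1 / p) := by
  intro ε hε
  obtain ⟨C, hC, h⟩ := hN ε hε
  refine ⟨C, hC, fun u v => ?_⟩
  simp only [← ENNReal.rpow_mul, one_div_mul_cancel hp.ne', ENNReal.rpow_one]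
  rw [Finset.mul_sum, ← Finset.sum_add_distrib, ← Finset.sum_add_distrib, Finset.mul_sum]
  refine Finset.sum_le_sum fun i _ => ?_
  simpa only [map_sub, map_smul, map_add] using h (L i u) (L i v)

theorem eLpNorm_ofReal_rpow {α : Type*} [MeasurableSpace α] {μ : Measure α} {p : ℝ} (hp : 0 < p)
    (f : α → ℝ) : eLpNorm f (ENNReal.ofReal p) μ ^ p = ∫⁻ x, ‖f x‖ₑ ^ p ∂μ := by
  rw [eLpNorm_eq_lintegral_rpow_enorm_toReal (by simpa using hp) ENNReal.ofReal_ne_top,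
    ENNReal.toReal_ofReal hp.le, ← ENNReal.rpow_mul, one_div_mul_cancel hp.ne', ENNReal.rpow_one]

theorem exists_eLpNorm_uniformConvex {α : Type*} [MeasurableSpace α] (μ : Measure α) {p : ℝ}
    (hp : 1 < p) {ε : ℝ} (hε : 0 < ε) :
    ∃ C : ℝ, 0 ≤ C ∧ ∀ f g : α → ℝ, AEStronglyMeasurable f μ → AEStronglyMeasurable g μ →
      eLpNorm (f - g) (ENNReal.ofReal p) μ ^ p +
        ENNReal.ofReal C * eLpNorm ((2⁻¹ : ℝ) • (f + g)) (ENNReal.ofReal p) μ ^ p ≤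
      ENNReal.ofReal (ε + C / 2) *
        (eLpNorm f (ENNReal.ofReal p) μ ^ p + eLpNorm g (ENNReal.ofReal p) μ ^ p) := by
  have hp0 : 0 < p := by linarith
  obtain ⟨C, hC, h⟩ := exists_abs_rpow_uniformConvex hp hε
  refine ⟨C, hC, fun f g hf hg => ?_⟩
  simp only [eLpNorm_ofReal_rpow hp0]
  have hm : ∀ f : α → ℝ, AEStronglyMeasurable f μ → AEMeasurable (fun x => ‖f x‖ₑ ^ p) μ :=
    fun f hf => hf.enorm.pow_const p
  rw [← lintegral_const_mul'' _ (hm _ ((hf.add hg).const_smul _)),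
    ← lintegral_add_left' (hm _ (hf.sub hg)), ← lintegral_add_left' (hm _ hf),
    ← lintegral_const_mul'' _ (by exact (hm _ hf).add (hm _ hg))]
  refine lintegral_mono fun x => ?_
  simp only [enorm_rpow_eq_ofReal hp0, Pi.sub_apply, Pi.smul_apply, Pi.add_apply, smul_eq_mul]
  rw [← ENNReal.ofReal_mul hC, ← ENNReal.ofReal_add (by positivity) (by positivity),
    ← ENNReal.ofReal_add (by positivity) (by positivity), ← ENNReal.ofReal_mul (by positivity)]
  exact ENNReal.ofReal_le_ofReal (h _ _)

theorem exists_eLpNorm_uniformSmooth {α : Type*} [MeasurableSpace α] (μ : Measure α) {q : ℝ}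
    (hq : 1 < q) {ε : ℝ} (hε : 0 < ε) :
    ∃ t : ℝ, 0 < t ∧ ∀ f g : α → ℝ, AEStronglyMeasurable f μ → AEStronglyMeasurable g μ →
      eLpNorm (f + t • g) (ENNReal.ofReal q) μ ^ q + eLpNorm (f - t • g) (ENNReal.ofReal q) μ ^ q ≤
      2 * eLpNorm f (ENNReal.ofReal q) μ ^ q + ENNReal.ofReal (ε * t) *
        (eLpNorm f (ENNReal.ofReal q) μ ^ q + eLpNorm g (ENNReal.ofReal q) μ ^ q) := by
  have hq0 : 0 < q := by linarith
  obtain ⟨t, ht, h⟩ := exists_abs_rpow_uniformSmooth hq hε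
  refine ⟨t, ht, fun f g hf hg => ?_⟩
  simp only [eLpNorm_ofReal_rpow hq0]
  have hm : ∀ f : α → ℝ, AEStronglyMeasurable f μ → AEMeasurable (fun x => ‖f x‖ₑ ^ q) μ :=
    fun f hf => hf.enorm.pow_const q
  rw [← lintegral_const_mul'' _ (hm _ hf), ← lintegral_add_left' (hm _ hf),
    ← lintegral_add_left' (hm _ (hf.add (hg.const_smul t))),
    ← lintegral_const_mul'' _ (by exact (hm _ hf).add (hm _ hg)),
    ← lintegral_add_left' ((hm _ hf).const_mul _)]
  refine lintegral_mono fun x => ?_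
  have h2 : (2 : ℝ≥0∞) = ENNReal.ofReal 2 := by simp
  simp only [enorm_rpow_eq_ofReal hq0, Pi.sub_apply, Pi.smul_apply, Pi.add_apply, smul_eq_mul]
  rw [h2, ← ENNReal.ofReal_mul zero_le_two, ← ENNReal.ofReal_add (by positivity) (by positivity),
    ← ENNReal.ofReal_add (by positivity) (by positivity), ← ENNReal.ofReal_mul (by positivity),
    ← ENNReal.ofReal_add (by positivity) (by positivity)]
  exact ENNReal.ofReal_le_ofReal (h _ _)

section Norms

variable {n : ℕ} {Ω : Opens (EuclideanSpace ℝ (Fin n))}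

theorem integrable_mul_testFunction {p : ℝ} (hp : 1 < p) {f : EuclideanSpace ℝ (Fin n) → ℝ}
    (hf : MemLp f (ENNReal.ofReal p) (volume.restrict (Ω : Set (EuclideanSpace ℝ (Fin n)))))
    (φ : 𝓓(Ω, ℝ)) :
    Integrable (fun x => f x * φ x) (volume.restrict (Ω : Set (EuclideanSpace ℝ (Fin n)))) := by
  have hp1 : (1 : ℝ≥0∞) ≤ ENNReal.ofReal p := by
    simpa using ENNReal.ofReal_le_ofReal hp.le
  simpa [mul_comm] using TestFunction.integrable_bilin (ContinuousLinearMap.mul ℝ ℝ)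
    ((hf.locallyIntegrable hp1).locallyIntegrableOn _) φ

theorem IsLpRep.add {p : ℝ} (hp : 1 < p) {T S : 𝓓'(Ω, ℝ)} {f g : EuclideanSpace ℝ (Fin n) → ℝ}
    (hf : IsLpRep p T f) (hg : IsLpRep p S g) : IsLpRep p (T + S) (f + g) := by
  refine ⟨hf.1.add hg.1, fun φ => ?_⟩
  have : (T + S) φ = T φ + S φ := rfl
  rw [this, hf.2, hg.2, ← integral_add (integrable_mul_testFunction hp hf.1 φ)
    (integrable_mul_testFunction hp hg.1 φ)]
  simp [add_mul]

theorem IsLpRep.smul {p : ℝ} {T : 𝓓'(Ω, ℝ)} {f : EuclideanSpace ℝ (Fin n) → ℝ} (c : ℝ)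
    (hf : IsLpRep p T f) : IsLpRep p (c • T) (c • f) := by
  refine ⟨hf.1.const_smul c, fun φ => ?_⟩
  have : (c • T) φ = c * T φ := rfl
  rw [this, hf.2, ← integral_const_mul]
  simp [mul_assoc]

theorem IsLpRep.sub {p : ℝ} (hp : 1 < p) {T S : 𝓓'(Ω, ℝ)} {f g : EuclideanSpace ℝ (Fin n) → ℝ}
    (hf : IsLpRep p T f) (hg : IsLpRep p S g) : IsLpRep p (T - S) (f - g) := by
  simpa [sub_eq_add_neg] using hf.add hp (hg.smul (-1))

theorem IsLpRep.ae_eq {p : ℝ} (hp : 1 < p) {T : 𝓓'(Ω, ℝ)} {f g : EuclideanSpace ℝ (Fin n) → ℝ}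
    (hf : IsLpRep p T f) (hg : IsLpRep p T g) :
    f =ᵐ[volume.restrict (Ω : Set (EuclideanSpace ℝ (Fin n)))] g := by
  have hp1 : (1 : ℝ≥0∞) ≤ ENNReal.ofReal p := by
    simpa using ENNReal.ofReal_le_ofReal hp.le
  have h := hf.sub hp hg
  rw [sub_self] at h
  have h0 := Ω.isOpen.ae_eq_zero_of_integral_contDiff_smul_eq_zero
    (μ := volume.restrict (Ω : Set (EuclideanSpace ℝ (Fin n)))) (f := f - g)
    ((h.1.locallyIntegrable hp1).locallyIntegrableOn _) (fun φ h1 h2 h3 => by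
      have h4 : (0 : 𝓓'(Ω, ℝ)) (⟨φ, h1, h2, h3⟩ : 𝓓(Ω, ℝ)) = _ := h.2 ⟨φ, h1, h2, h3⟩
      have h5 : (0 : 𝓓'(Ω, ℝ)) (⟨φ, h1, h2, h3⟩ : 𝓓(Ω, ℝ)) = 0 := rfl
      rw [h5] at h4
      simpa [mul_comm] using h4.symm)
  filter_upwards [h0, ae_restrict_mem Ω.isOpen.measurableSet] with x hx hxΩ
  exact sub_eq_zero.1 (hx hxΩ)

theorem IsLpRep.lpENorm_eq {p : ℝ} (hp : 1 < p) {T : 𝓓'(Ω, ℝ)}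
    {f : EuclideanSpace ℝ (Fin n) → ℝ} (hf : IsLpRep p T f) :
    lpENorm p T = eLpNorm f (ENNReal.ofReal p)
      (volume.restrict (Ω : Set (EuclideanSpace ℝ (Fin n)))) :=
  le_antisymm (iInf₂_le f hf) (le_iInf₂ fun _ hg => (eLpNorm_congr_ae (hf.ae_eq hp hg)).le)

theorem exists_isLpRep_of_lpENorm_ne_top {p : ℝ} {T : 𝓓'(Ω, ℝ)} (hT : lpENorm p T ≠ ⊤) :
    ∃ f, IsLpRep p T f := by
  by_contra! h
  exact hT (by simp [lpENorm, h])

theorem pUniformlyConvex_lpENorm {p : ℝ} (hp : 1 < p) :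
    PUniformlyConvex p (lpENorm p : 𝓓'(Ω, ℝ) → ℝ≥0∞) := by
  intro ε hε
  have hp0 : 0 < p := by linarith
  obtain ⟨C, hC, h⟩ := exists_eLpNorm_uniformConvex
    (volume.restrict (Ω : Set (EuclideanSpace ℝ (Fin n)))) hp hε
  have hεC : ENNReal.ofReal (ε + C / 2) ≠ 0 := by
    simp only [ne_eq, ENNReal.ofReal_eq_zero, not_le]; positivity
  refine ⟨C, hC, fun u v => ?_⟩
  by_cases hu : lpENorm p u = ⊤
  · simp [hu, hp0, ENNReal.mul_top hεC]
  by_cases hv : lpENorm p v = ⊤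
  · simp [hv, hp0, ENNReal.mul_top hεC]
  obtain ⟨f, hf⟩ := exists_isLpRep_of_lpENorm_ne_top hu
  obtain ⟨g, hg⟩ := exists_isLpRep_of_lpENorm_ne_top hv
  rw [hf.lpENorm_eq hp, hg.lpENorm_eq hp, (hf.sub hp hg).lpENorm_eq hp,
    ((hf.add hp hg).smul 2⁻¹).lpENorm_eq hp]
  exact h f g hf.1.1 hg.1.1

theorem exists_testENorm_uniformSmooth (r : ℕ) {q : ℝ} (hq : 1 < q) {ε : ℝ} (hε : 0 < ε) :
    ∃ t : ℝ, 0 < t ∧ ∀ φ ψ : 𝓓(Ω, ℝ),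
      testENorm r q (φ + t • ψ) ^ q + testENorm r q (φ - t • ψ) ^ q ≤
      2 * testENorm r q φ ^ q +
        ENNReal.ofReal (ε * t) * (testENorm r q φ ^ q + testENorm r q ψ ^ q) := by
  have hq0 : 0 < q := by linarith
  obtain ⟨t, ht, h⟩ := exists_eLpNorm_uniformSmooth
    (volume.restrict (Ω : Set (EuclideanSpace ℝ (Fin n)))) hq hε
  refine ⟨t, ht, fun φ ψ => ?_⟩
  simp only [testENorm, ← ENNReal.rpow_mul, one_div_mul_cancel hq0.ne', ENNReal.rpow_one]
  rw [← Finset.sum_add_distrib, ← Finset.sum_add_distrib, Finset.mul_sum, Finset.mul_sum,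
    ← Finset.sum_add_distrib]
  refine Finset.sum_le_sum fun α _ => ?_
  rw [map_sub, map_add, map_smul]
  exact h (pderiv 𝓓(Ω, ℝ) α φ) (pderiv 𝓓(Ω, ℝ) α ψ) (pderiv 𝓓(Ω, ℝ) α φ).aestronglyMeasurable
    (pderiv 𝓓(Ω, ℝ) α ψ).aestronglyMeasurable

theorem abs_apply_le_negENorm_mul {p : ℝ} (hp : 1 < p) (r : ℕ) (T : 𝓓'(Ω, ℝ))
    (hT : negENorm r p T ≠ ⊤) (φ : 𝓓(Ω, ℝ)) :
    |T φ| ≤ (negENorm r p T).toReal * (testENorm r p.conjExponent φ).toReal := by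
  have hq : 1 < p.conjExponent := (Real.HolderConjugate.conjExponent hp).symm.lt
  have ht := testENorm_ne_top hq r φ
  set t := testENorm r p.conjExponent φ with htdef
  -- `φ` is normalized by `t + δ`, since `t` could vanish
  have key : ∀ δ : ℝ, 0 < δ → |T φ| ≤ (negENorm r p T).toReal * (t.toReal + δ) := by
    intro δ hδ
    have hs : 0 < t.toReal + δ := add_pos_of_nonneg_of_pos ENNReal.toReal_nonneg hδ
    have hc : (0 : ℝ) < (t.toReal + δ)⁻¹ := inv_pos.2 hs
    have hle : testENorm r p.conjExponent ((t.toReal + δ)⁻¹ • φ) ≤ 1 := by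
      rw [testENorm_smul hq, ← htdef, Real.enorm_of_nonneg hc.le, ← ENNReal.ofReal_toReal ht,
        ENNReal.toReal_ofReal ENNReal.toReal_nonneg, ← ENNReal.ofReal_mul hc.le,
        ENNReal.ofReal_le_one, inv_mul_le_one₀ hs]
      linarith
    have h : ‖T ((t.toReal + δ)⁻¹ • φ)‖ₑ ≤ negENorm r p T :=
      le_iSup₂ (f := fun (φ : 𝓓(Ω, ℝ)) (_ : testENorm r p.conjExponent φ ≤ 1) => ‖T φ‖ₑ) _ hle
    have h' := ENNReal.toReal_mono hT h
    rw [toReal_enorm, map_smul, norm_smul, Real.norm_of_nonneg hc.le, Real.norm_eq_abs,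
      inv_mul_le_iff₀ hs] at h'
    linarith
  have hcont : Continuous fun δ : ℝ => (negENorm r p T).toReal * (t.toReal + δ) := by fun_prop
  have hlim := (hcont.tendsto 0).mono_left (nhdsWithin_le_nhds (s := Ioi 0))
  rw [add_zero] at hlim
  exact ge_of_tendsto hlim (eventually_mem_nhdsWithin.mono key)

end Norms

/-- A rescaling of `x` at which Young's inequality for the pair `h`, `x'` is an equality when `x`
norms `h`; the factor `|h x|^(p - 1)` is the one for which `N x' ^ q` and `h x'` balance. -/
theorem exists_apply_eq_abs_rpow {V : Type*} [AddCommGroup V] [Module ℝ V] {p q : ℝ}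
    (hpq : p.HolderConjugate q) {N : V → ℝ} (hN0 : ∀ x, 0 ≤ N x)
    (hNs : ∀ (c : ℝ) x, N (c • x) = |c| * N x) (h : V →ₗ[ℝ] ℝ) {x : V} (hx : N x ≤ 1) :
    ∃ x', h x' = |h x| ^ p ∧ N x' ^ q ≤ |h x| ^ p := by
  obtain ⟨σ, hσ, hσx⟩ : ∃ σ : ℝ, |σ| = 1 ∧ σ * h x = |h x| := by
    rcases abs_choice (h x) with h' | h'
    · exact ⟨1, by simp, by simp [h']⟩
    · exact ⟨-1, by simp, by simp [h']⟩
  have habs : (0 : ℝ) ≤ |h x| := abs_nonneg _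
  refine ⟨(|h x| ^ (p - 1) * σ) • x, ?_, ?_⟩
  · rw [map_smul, smul_eq_mul, mul_assoc, hσx, ← Real.rpow_add_one' habs (by linarith [hpq.lt])]
    simp
  · rw [hNs, abs_mul, hσ, mul_one, abs_of_nonneg (by positivity)]
    calc (|h x| ^ (p - 1) * N x) ^ q ≤ (|h x| ^ (p - 1) * 1) ^ q := by
          have := hN0 x
          have := hpq.symm.nonneg
          gcongr
      _ = |h x| ^ p := by rw [mul_one, ← Real.rpow_mul habs, hpq.sub_one_mul_conj]

/-- Duality between smoothness and convexity (Lindenstrauss): if the seminorm `N` is uniformly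
smooth, then the dual norm is uniformly convex. The functionals `f` and `g` are evaluated at
`x' + t y'` and `x' - t y'`, where `x'`, `y'` are multiples of `x`, `y`, and the values are
estimated by Young's inequality. -/
theorem dual_uniformConvex {V : Type*} [AddCommGroup V] [Module ℝ V] {p q : ℝ}
    (hpq : p.HolderConjugate q) {N : V → ℝ} (hN0 : ∀ x, 0 ≤ N x)
    (hNs : ∀ (c : ℝ) x, N (c • x) = |c| * N x) {ε t : ℝ} (hε : 0 < ε) (hε2 : ε ≤ 1 / 2)
    (ht : 0 < t)
    (hN : ∀ x y, N (x + t • y) ^ q + N (x - t • y) ^ q ≤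
      2 * N x ^ q + q * ε * t * (N x ^ q + N y ^ q))
    {f g : V →ₗ[ℝ] ℝ} {a b : ℝ} (ha : 0 ≤ a) (hb : 0 ≤ b) (hf : ∀ x, |f x| ≤ a * N x)
    (hg : ∀ x, |g x| ≤ b * N x) {x y : V} (hx : N x ≤ 1) (hy : N y ≤ 1) :
    |f y - g y| ^ p + 2 / (p * (t * (1 - ε))) * |2⁻¹ * (f x + g x)| ^ p ≤
      (ε + 2 / (p * (t * (1 - ε))) / 2) * (a ^ p + b ^ p) := by
  have hp0 : 0 < p := hpq.pos
  have hq0 : 0 < q := hpq.symm.pos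
  obtain ⟨x', hx', hNx'⟩ := exists_apply_eq_abs_rpow hpq hN0 hNs ((2⁻¹ : ℝ) • (f + g)) hx
  obtain ⟨y', hy', hNy'⟩ := exists_apply_eq_abs_rpow hpq hN0 hNs (f - g) hy
  simp only [LinearMap.smul_apply, LinearMap.add_apply, LinearMap.sub_apply, smul_eq_mul]
    at hx' hNx' hy' hNy'
  -- the midpoint term is also bounded by convexity of the power
  have hc : |2⁻¹ * (f x + g x)| ^ p ≤ (a ^ p + b ^ p) / 2 := by
    have h1 : |2⁻¹ * (f x + g x)| ≤ 2⁻¹ * a + 2⁻¹ * b := by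
      have hfx : |f x| ≤ a := (hf x).trans (mul_le_of_le_one_right ha hx)
      have hgx : |g x| ≤ b := (hg x).trans (mul_le_of_le_one_right hb hx)
      rw [abs_mul, abs_of_pos (by norm_num : (0 : ℝ) < 2⁻¹), ← mul_add]
      gcongr
      exact (abs_add_le _ _).trans (add_le_add hfx hgx)
    have h2 := (convexOn_rpow hpq.lt.le).2 ha hb
      (by norm_num : (0 : ℝ) ≤ 2⁻¹) (by norm_num : (0 : ℝ) ≤ 2⁻¹) (by norm_num)
    simp only [smul_eq_mul] at h2
    calc |2⁻¹ * (f x + g x)| ^ p ≤ (2⁻¹ * a + 2⁻¹ * b) ^ p :=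
          Real.rpow_le_rpow (abs_nonneg _) h1 hp0.le
      _ ≤ 2⁻¹ * a ^ p + 2⁻¹ * b ^ p := h2
      _ = (a ^ p + b ^ p) / 2 := by ring
  set c := |2⁻¹ * (f x + g x)| ^ p
  set d := |f y - g y| ^ p
  have h1 : f (x' + t • y') ≤ a ^ p / p + N (x' + t • y') ^ q / q :=
    ((le_abs_self _).trans (hf _)).trans (Real.young_inequality_of_nonneg ha (hN0 _) hpq)
  have h2 : g (x' - t • y') ≤ b ^ p / p + N (x' - t • y') ^ q / q :=
    ((le_abs_self _).trans (hg _)).trans (Real.young_inequality_of_nonneg hb (hN0 _) hpq)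
  rw [map_add, map_smul, smul_eq_mul] at h1
  rw [map_sub, map_smul, smul_eq_mul] at h2
  have h3 : (N (x' + t • y') ^ q + N (x' - t • y') ^ q) / q ≤ 2 * c / q + ε * t * (c + d) := by
    have h4 : N (x' + t • y') ^ q + N (x' - t • y') ^ q ≤ 2 * c + q * ε * t * (c + d) :=
      (hN x' y').trans (by gcongr)
    calc _ ≤ (2 * c + q * ε * t * (c + d)) / q := by gcongr
      _ = _ := by field_simp
  have h5 : 2 * c / q = 2 * c - 2 * c / p := by
    have := hpq.inv_add_inv_eq_one
    have hq' : q⁻¹ = 1 - p⁻¹ := by linarith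
    rw [div_eq_mul_inv, hq', div_eq_mul_inv]; ring
  have h6 : t * (1 - ε) * d + 2 / p * c ≤ (1 / p + ε * t / 2) * (a ^ p + b ^ p) := by
    have h7 : f x' + g x' = 2 * c := by linarith
    have h8 : t * (f y' - g y') = t * d := by rw [hy']
    have h9 : ε * t * c ≤ ε * t * ((a ^ p + b ^ p) / 2) := by gcongr
    have h10 : 2 * c / p = 2 / p * c := by ring
    have h11 : (1 / p + ε * t / 2) * (a ^ p + b ^ p) =
      a ^ p / p + b ^ p / p + ε * t * ((a ^ p + b ^ p) / 2) := by ring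
    rw [add_div] at h3
    linarith
  have hκ : 0 < t * (1 - ε) := by
    have : 0 < 1 - ε := by linarith
    positivity
  have h12 : d + 2 / (p * (t * (1 - ε))) * c ≤
      (1 / p + ε * t / 2) * (a ^ p + b ^ p) / (t * (1 - ε)) := by
    rw [le_div_iff₀ hκ]
    have h1ε : 1 - ε ≠ 0 := by linarith
    calc _ = t * (1 - ε) * d + 2 / p * c := by field_simp
      _ ≤ _ := h6
  refine h12.trans ?_
  have hab : 0 ≤ a ^ p + b ^ p := by positivity
  rw [mul_div_right_comm]
  gcongr
  have h1ε : 0 < 1 - ε := by linarith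
  have h13 : ε * t / 2 ≤ ε * (t * (1 - ε)) := by nlinarith [mul_pos hε ht]
  calc (1 / p + ε * t / 2) / (t * (1 - ε)) ≤ (1 / p + ε * (t * (1 - ε))) / (t * (1 - ε)) := by
        gcongr
    _ = _ := by field_simp; ring

section Norms

variable {n : ℕ} {Ω : Opens (EuclideanSpace ℝ (Fin n))}

theorem pUniformlyConvex_negENorm {p : ℝ} (hp : 1 < p) (r : ℕ) :
    PUniformlyConvex p (negENorm r p : 𝓓'(Ω, ℝ) → ℝ≥0∞) := by
  intro ε hε
  have hp0 : 0 < p := by linarith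
  have hpq := Real.HolderConjugate.conjExponent hp
  have hq := hpq.symm.lt
  set q := p.conjExponent with hqdef
  have hq0 : 0 < q := by linarith
  set ε' := min ε (1 / 2) with hε'
  have hε'0 : 0 < ε' := by positivity
  have hε'2 : ε' ≤ 1 / 2 := min_le_right _ _
  obtain ⟨t, ht, h⟩ := exists_testENorm_uniformSmooth (Ω := Ω) r hq (mul_pos hq0 hε'0)
  set C := 2 / (p * (t * (1 - ε'))) with hCdef
  have hC : 0 ≤ C := by
    have : 0 < 1 - ε' := by linarith
    positivity
  have hεC : ENNReal.ofReal (ε + C / 2) ≠ 0 := by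
    simp only [ne_eq, ENNReal.ofReal_eq_zero, not_le]; positivity
  refine ⟨C, hC, fun u v => ?_⟩
  by_cases hu : negENorm r p u = ⊤
  · simp [hu, hp0, ENNReal.mul_top hεC]
  by_cases hv : negENorm r p v = ⊤
  · simp [hv, hp0, ENNReal.mul_top hεC]
  set N : 𝓓(Ω, ℝ) → ℝ := fun φ => (testENorm r q φ).toReal with hN
  have hNt : ∀ φ : 𝓓(Ω, ℝ), testENorm r q φ ≠ ⊤ := testENorm_ne_top hq r
  have hNr : ∀ φ : 𝓓(Ω, ℝ), testENorm r q φ ^ q = ENNReal.ofReal (N φ ^ q) := fun φ => by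
    rw [← ENNReal.ofReal_rpow_of_nonneg ENNReal.toReal_nonneg hq0.le, ENNReal.ofReal_toReal (hNt φ)]
  have hN0 : ∀ φ, 0 ≤ N φ := fun φ => ENNReal.toReal_nonneg
  have hsmooth : ∀ φ ψ, N (φ + t • ψ) ^ q + N (φ - t • ψ) ^ q ≤
      2 * N φ ^ q + q * ε' * t * (N φ ^ q + N ψ ^ q) := by
    intro φ ψ
    have h1 := h φ ψ
    have h2 : ∀ x : ℝ≥0∞, 2 * x = ENNReal.ofReal 2 * x := by simp
    have hpos : ∀ φ, 0 ≤ N φ ^ q := fun φ => Real.rpow_nonneg (hN0 φ) q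
    simp only [hNr] at h1
    rw [h2, ← ENNReal.ofReal_mul zero_le_two, ← ENNReal.ofReal_add (hpos _) (hpos _),
      ← ENNReal.ofReal_add (hpos _) (hpos _), ← ENNReal.ofReal_mul (by positivity),
      ← ENNReal.ofReal_add (mul_nonneg zero_le_two (hpos _))
        (mul_nonneg (by positivity) (add_nonneg (hpos _) (hpos _))),
      ENNReal.ofReal_le_ofReal_iff (add_nonneg (mul_nonneg zero_le_two (hpos _))
        (mul_nonneg (by positivity) (add_nonneg (hpos _) (hpos _))))] at h1
    exact h1
  have hNs : ∀ (c : ℝ) φ, N (c • φ) = |c| * N φ := fun c φ => by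
    simp only [hN]
    rw [testENorm_smul hq, ENNReal.toReal_mul, toReal_enorm, Real.norm_eq_abs]
  set a := (negENorm r p u).toReal with ha
  set b := (negENorm r p v).toReal with hb
  have ha0 : 0 ≤ a := ENNReal.toReal_nonneg
  have hb0 : 0 ≤ b := ENNReal.toReal_nonneg
  have hr : ENNReal.ofReal (ε + C / 2) * (negENorm r p u ^ p + negENorm r p v ^ p) =
      ENNReal.ofReal ((ε + C / 2) * (a ^ p + b ^ p)) := by
    rw [ENNReal.ofReal_mul (by positivity),
      ENNReal.ofReal_add (p := a ^ p) (by positivity) (by positivity),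
      ← ENNReal.ofReal_rpow_of_nonneg ha0 hp0.le, ← ENNReal.ofReal_rpow_of_nonneg hb0 hp0.le,
      ha, hb, ENNReal.ofReal_toReal hu, ENNReal.ofReal_toReal hv]
  have hsup : ∀ T : 𝓓'(Ω, ℝ), negENorm r p T ^ p =
      ⨆ φ : {φ : 𝓓(Ω, ℝ) // testENorm r q φ ≤ 1}, ‖T φ‖ₑ ^ p := fun T => by
    have := (ENNReal.orderIsoRpow p hp0).map_iSup
      fun φ : {φ : 𝓓(Ω, ℝ) // testENorm r q φ ≤ 1} => ‖T φ‖ₑ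
    simp only [ENNReal.orderIsoRpow_apply] at this
    rw [← this, negENorm, iSup_subtype]
  have : Nonempty {φ : 𝓓(Ω, ℝ) // testENorm r q φ ≤ 1} :=
    ⟨⟨0, by
      have := testENorm_smul hq r 0 (0 : 𝓓(Ω, ℝ))
      rw [zero_smul] at this
      rw [enorm_zero, zero_mul] at this
      exact this.trans_le zero_le⟩⟩
  rw [hr, hsup, hsup, ENNReal.mul_iSup]
  refine ENNReal.iSup_add_iSup_le ?_
  rintro ⟨y, hy⟩ ⟨x, hx⟩
  have hx' : N x ≤ 1 := ENNReal.toReal_le_of_le_ofReal zero_le_one (by simpa using hx)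
  have hy' : N y ≤ 1 := ENNReal.toReal_le_of_le_ofReal zero_le_one (by simpa using hy)
  have h1 : (u - v) y = u y - v y := rfl
  have h2 : ((2⁻¹ : ℝ) • (u + v)) x = 2⁻¹ * (u x + v x) := rfl
  simp only [h1, h2, enorm_rpow_eq_ofReal hp0]
  rw [← ENNReal.ofReal_mul hC, ← ENNReal.ofReal_add (by positivity) (by positivity)]
  refine ENNReal.ofReal_le_ofReal ((dual_uniformConvex hpq hN0 hNs hε'0 hε'2 ht hsmooth
    (f := u.toLinearMap) (g := v.toLinearMap) ha0 hb0
    (abs_apply_le_negENorm_mul hp r u hu) (abs_apply_le_negENorm_mul hp r v hv)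
    hx' hy').trans ?_)
  gcongr
  exact min_le_left _ _

theorem pUniformlyConvex_sobENorm {p : ℝ} (hp : 1 < p) (s : ℤ) :
    PUniformlyConvex p (sobENorm s p : 𝓓'(Ω, ℝ) → ℝ≥0∞) := by
  cases s with
  | ofNat r =>
    exact (pUniformlyConvex_lpENorm hp).sum (by linarith) (multiIdx n r)
      fun α => (pderiv 𝓓'(Ω, ℝ) α).toLinearMap
  | negSucc r => exact pUniformlyConvex_negENorm hp (r + 1)

theorem pUniformlyConvex_vecENorm {k : ℕ} {p : ℝ} (hp : 1 < p) (s : ℤ) :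
    PUniformlyConvex p (vecENorm s p : (Fin k → 𝓓'(Ω, ℝ)) → ℝ≥0∞) :=
  (pUniformlyConvex_sobENorm hp s).sum (by linarith) Finset.univ
    fun j => LinearMap.proj j

end Norms

/-! ### Completeness of the Sobolev spaces -/

section Complete

variable {n : ℕ} {Ω : Opens (EuclideanSpace ℝ (Fin n))}

/-- The derivatives of distributions are transposes of operators on test functions; hence they are
continuous for pointwise convergence. -/
theorem exists_pderiv_apply_eq (α : Fin n → ℕ) (φ : 𝓓(Ω, ℝ)) :
    ∃ ψ : 𝓓(Ω, ℝ), ∀ T : 𝓓'(Ω, ℝ), pderiv 𝓓'(Ω, ℝ) α T φ = T ψ := by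
  let P : (𝓓'(Ω, ℝ) →L[ℝ] 𝓓'(Ω, ℝ)) → Prop := fun L =>
    ∀ φ : 𝓓(Ω, ℝ), ∃ ψ : 𝓓(Ω, ℝ), ∀ T : 𝓓'(Ω, ℝ), L T φ = T ψ
  have hone : P 1 := fun φ => ⟨φ, fun _ => rfl⟩
  have hmul : ∀ L₁ L₂, P L₁ → P L₂ → P (L₁ * L₂) := by
    intro L₁ L₂ h₁ h₂ φ
    obtain ⟨ψ₁, hψ₁⟩ := h₁ φ
    obtain ⟨ψ₂, hψ₂⟩ := h₂ ψ₁
    exact ⟨ψ₂, fun T => (hψ₁ (L₂ T)).trans (hψ₂ T)⟩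
  have hpow : ∀ L, P L → ∀ i : ℕ, P (L ^ i) := by
    intro L hL i
    induction i with
    | zero => simpa using hone
    | succ i ih => rw [pow_succ]; exact hmul _ _ ih hL
  have hderiv : ∀ v, P (LineDeriv.lineDerivOpCLM ℝ 𝓓'(Ω, ℝ) v) :=
    fun v φ => ⟨-∂_{v} φ, fun T => Distribution.lineDerivOp_apply_apply T φ v⟩
  suffices h : P (pderiv 𝓓'(Ω, ℝ) α) from h φ
  refine List.prod_induction P hmul hone ?_
  intro L hL
  obtain ⟨j, -, rfl⟩ := List.mem_map.1 hL
  exact hpow _ (hderiv _) _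

/-- Completeness of the space of distributions with finite `N`, for an extended norm `N` whose
topology is finer than pointwise convergence. -/
def DistrComplete (N : 𝓓'(Ω, ℝ) → ℝ≥0∞) : Prop :=
  ∀ T : ℕ → 𝓓'(Ω, ℝ), (∀ i, N (T i) ≠ ⊤) →
    (∀ ε : ℝ≥0∞, 0 < ε → ∃ K, ∀ i, K ≤ i → ∀ j, K ≤ j → N (T i - T j) < ε) →
    ∃ S : 𝓓'(Ω, ℝ), (∀ φ, Tendsto (fun i => T i φ) atTop (𝓝 (S φ))) ∧
      Tendsto (fun i => N (T i - S)) atTop (𝓝 0)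

theorem IsLpRep.enorm_apply_le {p : ℝ} (hp : 1 < p) {T : 𝓓'(Ω, ℝ)}
    {f : EuclideanSpace ℝ (Fin n) → ℝ} (hf : IsLpRep p T f) (φ : 𝓓(Ω, ℝ)) :
    ‖T φ‖ₑ ≤ lpENorm p T * eLpNorm φ (ENNReal.ofReal p.conjExponent)
      (volume.restrict (Ω : Set (EuclideanSpace ℝ (Fin n)))) := by
  have hpq : ENNReal.HolderConjugate (ENNReal.ofReal p) (ENNReal.ofReal p.conjExponent) :=
    (Real.HolderConjugate.conjExponent hp).ennrealOfReal
  have h1 : ‖T φ‖ₑ ≤ eLpNorm (f • (φ : EuclideanSpace ℝ (Fin n) → ℝ)) 1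
      (volume.restrict (Ω : Set (EuclideanSpace ℝ (Fin n)))) := by
    rw [hf.2, eLpNorm_one_eq_lintegral_enorm]
    exact enorm_integral_le_lintegral_enorm _
  rw [hf.lpENorm_eq hp]
  exact h1.trans (eLpNorm_smul_le_mul_eLpNorm (p := ENNReal.ofReal p)
    (q := ENNReal.ofReal p.conjExponent) φ.aestronglyMeasurable hf.1.1)

theorem exists_isLpRep {p : ℝ} (hp : 1 < p) {f : EuclideanSpace ℝ (Fin n) → ℝ}
    (hf : MemLp f (ENNReal.ofReal p) (volume.restrict (Ω : Set (EuclideanSpace ℝ (Fin n))))) :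
    ∃ T : 𝓓'(Ω, ℝ), IsLpRep p T f := by
  have hp1 : (1 : ℝ≥0∞) ≤ ENNReal.ofReal p := by
    simpa using ENNReal.ofReal_le_ofReal hp.le
  refine ⟨TestFunction.integralAgainstBilinCLM (ContinuousLinearMap.mul ℝ ℝ)
    (volume.restrict (Ω : Set (EuclideanSpace ℝ (Fin n)))) f, hf, fun φ => ?_⟩
  refine (TestFunction.integralAgainstBilinCLM_eq_integral
    ((hf.locallyIntegrable hp1).locallyIntegrableOn _)).trans ?_
  simp [mul_comm]

theorem distrComplete_lpENorm {p : ℝ} (hp : 1 < p) :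
    DistrComplete (lpENorm p : 𝓓'(Ω, ℝ) → ℝ≥0∞) := by
  intro T hT hC
  have : Fact ((1 : ℝ≥0∞) ≤ ENNReal.ofReal p) :=
    ⟨by simpa using ENNReal.ofReal_le_ofReal hp.le⟩
  choose f hf using fun i => exists_isLpRep_of_lpENorm_ne_top (hT i)
  have hcauchy : CauchySeq fun i => (hf i).1.toLp (f i) := by
    refine EMetric.cauchySeq_iff.2 fun ε hε => ?_
    obtain ⟨K, hK⟩ := hC ε hε
    refine ⟨K, fun i hi j hj => ?_⟩
    rw [Lp.edist_toLp_toLp, ← ((hf i).sub hp (hf j)).lpENorm_eq hp]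
    exact hK i hi j hj
  obtain ⟨g, hg⟩ := cauchySeq_tendsto_of_complete hcauchy
  obtain ⟨S, hS⟩ := exists_isLpRep (Ω := Ω) hp (Lp.memLp g)
  have hlim : Tendsto (fun i => lpENorm p (T i - S)) atTop (𝓝 0) := by
    refine (tendsto_iff_edist_tendsto_0.1 hg).congr fun i => ?_
    rw [((hf i).sub hp hS).lpENorm_eq hp, ← Lp.edist_toLp_toLp _ _ (hf i).1 (Lp.memLp g),
      Lp.toLp_coeFn]
  refine ⟨S, fun φ => ?_, hlim⟩
  refine tendsto_iff_edist_tendsto_0.2 ?_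
  have hb := ENNReal.Tendsto.mul_const hlim
    (b := eLpNorm φ (ENNReal.ofReal p.conjExponent)
      (volume.restrict (Ω : Set (EuclideanSpace ℝ (Fin n))))) (Or.inr (eLpNorm_test_ne_top _ φ))
  rw [zero_mul] at hb
  refine tendsto_of_tendsto_of_tendsto_of_le_of_le tendsto_const_nhds hb (fun _ => zero_le)
    fun i => ?_
  rw [edist_eq_enorm_sub]
  exact ((hf i).sub hp hS).enorm_apply_le hp φ

theorem tendsto_rpow_sum_rpow {ι : Type*} {p : ℝ} (hp : 0 < p) (s : Finset ι)
    {a : ι → ℕ → ℝ≥0∞} (ha : ∀ i ∈ s, Tendsto (a i) atTop (𝓝 0)) :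
    Tendsto (fun j => (∑ i ∈ s, a i j ^ p) ^ (1 / p)) atTop (𝓝 0) := by
  have h1 : Tendsto (fun j => ∑ i ∈ s, a i j ^ p) atTop (𝓝 (∑ _i ∈ s, 0)) := by
    refine tendsto_finsetSum s fun i hi => ?_
    have := (ENNReal.continuous_rpow_const (y := p)).tendsto 0
    rw [ENNReal.zero_rpow_of_pos hp] at this
    exact this.comp (ha i hi)
  rw [Finset.sum_const_zero] at h1
  have h2 := (ENNReal.continuous_rpow_const (y := 1 / p)).tendsto 0
  rw [ENNReal.zero_rpow_of_pos (by positivity)] at h2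
  exact h2.comp h1

theorem le_rpow_sum_rpow {ι : Type*} {p : ℝ} (hp : 0 < p) {s : Finset ι} (a : ι → ℝ≥0∞) {i : ι}
    (hi : i ∈ s) : a i ≤ (∑ i ∈ s, a i ^ p) ^ (1 / p) := by
  rw [one_div, ENNReal.le_rpow_inv_iff hp]
  exact Finset.single_le_sum (f := fun i => a i ^ p) (fun _ _ => zero_le) hi

theorem distrComplete_posENorm {p : ℝ} (hp : 1 < p) (r : ℕ) :
    DistrComplete (posENorm r p : 𝓓'(Ω, ℝ) → ℝ≥0∞) := by
  intro T hT hC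
  have hp0 : 0 < p := by linarith
  have hle : ∀ α ∈ multiIdx n r, ∀ T : 𝓓'(Ω, ℝ),
      lpENorm p (pderiv 𝓓'(Ω, ℝ) α T) ≤ posENorm r p T := fun α hα T =>
    le_rpow_sum_rpow hp0 (fun α => lpENorm p (pderiv 𝓓'(Ω, ℝ) α T)) hα
  have hex : ∀ α ∈ multiIdx n r, ∃ S : 𝓓'(Ω, ℝ),
      (∀ φ, Tendsto (fun i => pderiv 𝓓'(Ω, ℝ) α (T i) φ) atTop (𝓝 (S φ))) ∧
      Tendsto (fun i => lpENorm p (pderiv 𝓓'(Ω, ℝ) α (T i) - S)) atTop (𝓝 0) := by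
    intro α hα
    refine distrComplete_lpENorm hp (fun i => pderiv 𝓓'(Ω, ℝ) α (T i))
      (fun i => ne_top_of_le_ne_top (hT i) (hle α hα _)) fun ε hε => ?_
    obtain ⟨K, hK⟩ := hC ε hε
    refine ⟨K, fun i hi j hj => ?_⟩
    rw [← map_sub]
    exact (hle α hα _).trans_lt (hK i hi j hj)
  obtain ⟨S, hS, -⟩ := hex 0 (mem_multiIdx.2 (by simp))
  simp only [pderiv_zero] at hS
  refine ⟨S, hS, tendsto_rpow_sum_rpow hp0 _ fun α hα => ?_⟩
  obtain ⟨Sα, hSα, hlim⟩ := hex α hα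
  have : pderiv 𝓓'(Ω, ℝ) α S = Sα := by
    ext φ
    obtain ⟨ψ, hψ⟩ := exists_pderiv_apply_eq α φ
    refine tendsto_nhds_unique ?_ (hSα φ)
    simp only [hψ]
    exact hS ψ
  simpa only [map_sub, this] using hlim

/-- On a set of finite measure, the Sobolev norms are continuous seminorms on test functions. -/
theorem tendsto_testENorm_nhds_zero (hΩ : volume (Ω : Set (EuclideanSpace ℝ (Fin n))) ≠ ⊤) (r : ℕ)
    {q : ℝ} (hq : 1 < q) : Tendsto (testENorm r q : 𝓓(Ω, ℝ) → ℝ≥0∞) (𝓝 0) (𝓝 0) := by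
  have hq0 : 0 < q := by linarith
  have hα : ∀ α : Fin n → ℕ, Tendsto (fun φ : 𝓓(Ω, ℝ) =>
      eLpNorm (pderiv 𝓓(Ω, ℝ) α φ) (ENNReal.ofReal q)
        (volume.restrict (Ω : Set (EuclideanSpace ℝ (Fin n)))) ^ q) (𝓝 0) (𝓝 0) := by
    intro α
    have hcont : Continuous fun φ : 𝓓(Ω, ℝ) =>
        ‖TestFunction.toBoundedContinuousFunctionCLM ℝ (pderiv 𝓓(Ω, ℝ) α φ)‖ₑ :=
      ((TestFunction.toBoundedContinuousFunctionCLM ℝ).continuous.comp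
        (pderiv 𝓓(Ω, ℝ) α).continuous).enorm
    have h0 := hcont.tendsto 0
    rw [map_zero, map_zero, enorm_zero] at h0
    have h1 := ENNReal.Tendsto.const_mul h0 (a := volume.restrict
      (Ω : Set (EuclideanSpace ℝ (Fin n))) univ ^ (ENNReal.ofReal q).toReal⁻¹)
      (Or.inr (ENNReal.rpow_ne_top_of_nonneg (by positivity) (by simpa using hΩ)))
    rw [mul_zero] at h1
    have h2 := (ENNReal.continuous_rpow_const (y := q)).tendsto 0
    rw [ENNReal.zero_rpow_of_pos hq0] at h2
    refine h2.comp (tendsto_of_tendsto_of_tendsto_of_le_of_le tendsto_const_nhds h1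
      (fun _ => zero_le) fun φ => ?_)
    refine (eLpNorm_le_of_ae_bound (Eventually.of_forall fun x =>
      (TestFunction.toBoundedContinuousFunctionCLM ℝ (pderiv 𝓓(Ω, ℝ) α φ)).norm_coe_le_norm x)).trans
      ?_
    rw [ofReal_norm]
  have h1 : Tendsto (fun φ : 𝓓(Ω, ℝ) => ∑ α ∈ multiIdx n r,
      eLpNorm (pderiv 𝓓(Ω, ℝ) α φ) (ENNReal.ofReal q)
        (volume.restrict (Ω : Set (EuclideanSpace ℝ (Fin n)))) ^ q) (𝓝 0)
      (𝓝 (∑ _α ∈ multiIdx n r, 0)) := tendsto_finsetSum _ fun α _ => hα α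
  rw [Finset.sum_const_zero] at h1
  have h2 := (ENNReal.continuous_rpow_const (y := 1 / q)).tendsto 0
  rw [ENNReal.zero_rpow_of_pos (by positivity)] at h2
  exact h2.comp h1

theorem distrComplete_negENorm (hΩ : volume (Ω : Set (EuclideanSpace ℝ (Fin n))) ≠ ⊤) {p : ℝ}
    (hp : 1 < p) (r : ℕ) : DistrComplete (negENorm r p : 𝓓'(Ω, ℝ) → ℝ≥0∞) := by
  intro T _ hC
  have hq : 1 < p.conjExponent := (Real.HolderConjugate.conjExponent hp).symm.lt
  have happly : ∀ i j φ, (T i - T j) φ = T i φ - T j φ := fun _ _ _ => rfl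
  have hsub : ∀ (c : ℝ) i j φ, negENorm r p (T i - T j) < ENNReal.ofReal c →
      |T i φ - T j φ| ≤ c * (testENorm r p.conjExponent φ).toReal := by
    intro c i j φ h
    have h1 := abs_apply_le_negENorm_mul hp r (T i - T j) h.ne_top φ
    rw [happly] at h1
    have h2 : (negENorm r p (T i - T j)).toReal ≤ c := by
      refine ENNReal.toReal_le_of_le_ofReal ?_ h.le
      by_contra! hc
      rw [ENNReal.ofReal_of_nonpos hc.le] at h
      exact not_lt_zero h
    exact h1.trans (mul_le_mul_of_nonneg_right h2 ENNReal.toReal_nonneg)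
  have hlim : ∀ φ, ∃ l, Tendsto (fun i => T i φ) atTop (𝓝 l) := by
    intro φ
    refine cauchySeq_tendsto_of_complete (Metric.cauchySeq_iff.2 fun ε hε => ?_)
    set t := (testENorm r p.conjExponent φ).toReal with ht
    have ht0 : 0 ≤ t := ENNReal.toReal_nonneg
    obtain ⟨K, hK⟩ := hC (ENNReal.ofReal (ε / (t + 1))) (ENNReal.ofReal_pos.2 (by positivity))
    refine ⟨K, fun i hi j hj => ?_⟩
    rw [Real.dist_eq]
    refine (hsub _ i j φ (hK i hi j hj)).trans_lt ?_
    rw [← ht, div_mul_eq_mul_div, div_lt_iff₀ (by positivity)]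
    linarith
  choose l hl using hlim
  obtain ⟨K, hK⟩ := hC (ENNReal.ofReal 1) (by simp)
  -- the limit differs from `T K` by a functional bounded by the norm of test functions
  let R : 𝓓(Ω, ℝ) →ₗ[ℝ] ℝ :=
    { toFun := fun φ => l φ - T K φ
      map_add' := fun φ ψ => by
        have : l (φ + ψ) = l φ + l ψ := tendsto_nhds_unique (hl (φ + ψ))
          (by simpa only [map_add] using (hl φ).add (hl ψ))
        rw [this, map_add]; ring
      map_smul' := fun c φ => by
        have : l (c • φ) = c * l φ := tendsto_nhds_unique (hl (c • φ))
          (by simpa only [map_smul, smul_eq_mul] using (hl φ).const_mul c)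
        rw [this, map_smul]; simp [mul_sub] }
  have hR : ∀ φ, |R φ| ≤ (testENorm r p.conjExponent φ).toReal := by
    intro φ
    refine le_of_tendsto ((hl φ).sub_const (T K φ)).abs
      ((eventually_ge_atTop K).mono fun i hi => ?_)
    simpa using hsub 1 i K φ (hK i hi K le_rfl)
  have hRc : Continuous R := by
    refine continuous_of_continuousAt_zero R ?_
    rw [ContinuousAt, map_zero]
    refine squeeze_zero_norm hR ?_
    have := (ENNReal.continuousAt_toReal ENNReal.zero_ne_top).tendsto.comp
      (tendsto_testENorm_nhds_zero hΩ r hq)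
    simpa [Function.comp_def] using this
  let R' : 𝓓'(Ω, ℝ) := (⟨R, hRc⟩ : 𝓓(Ω, ℝ) →L[ℝ] ℝ)
  have hS : ∀ φ, (R' + T K) φ = l φ := fun φ => sub_add_cancel (l φ) (T K φ)
  refine ⟨R' + T K, fun φ => by rw [hS]; exact hl φ, ?_⟩
  refine ENNReal.tendsto_atTop_zero.2 fun ε hε => ?_
  obtain ⟨K', hK'⟩ := hC ε hε
  refine ⟨K', fun i hi => iSup₂_le fun φ hφ => ?_⟩
  have h1 : (T i - (R' + T K)) φ = T i φ - l φ := by rw [← hS]; rfl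
  rw [h1]
  refine le_of_tendsto ((hl φ).const_sub (T i φ)).enorm
    ((eventually_ge_atTop K').mono fun j hj => ?_)
  rw [← happly]
  exact (le_iSup₂ (f := fun (φ : 𝓓(Ω, ℝ)) (_ : testENorm r p.conjExponent φ ≤ 1) =>
    ‖(T i - T j) φ‖ₑ) φ hφ).trans (hK' i hi j hj).le

theorem distrComplete_sobENorm (hΩ : volume (Ω : Set (EuclideanSpace ℝ (Fin n))) ≠ ⊤) {p : ℝ}
    (hp : 1 < p) (s : ℤ) : DistrComplete (sobENorm s p : 𝓓'(Ω, ℝ) → ℝ≥0∞) := by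
  cases s with
  | ofNat r => exact distrComplete_posENorm hp r
  | negSucc r => exact distrComplete_negENorm hΩ hp (r + 1)

end Complete

section Space

variable {n k m : ℕ} {X : Opens (EuclideanSpace ℝ (Fin n))} {A : DiffOp n k m X}
  {D : Opens (EuclideanSpace ℝ (Fin n))} {hD : D ≤ X} {s : ℤ} {p : ℝ} {hp : 1 < p}

theorem SobolevSol.enorm_def (u : SobolevSol A D hD s p hp) : ‖u‖ₑ = vecENorm s p u.toDistr := by
  rw [← ofReal_norm, SobolevSol.norm_def]
  exact ENNReal.ofReal_toReal u.2.2.ne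

theorem SobolevSol.pUniformlyConvex_enorm :
    PUniformlyConvex p fun u : SobolevSol A D hD s p hp => ‖u‖ₑ := by
  intro ε hε
  obtain ⟨C, hC, h⟩ := pUniformlyConvex_vecENorm (Ω := D) (k := k) hp s ε hε
  refine ⟨C, hC, fun u v => ?_⟩
  simp only [SobolevSol.enorm_def]
  exact h u.toDistr v.toDistr

theorem SobolevSol.completeSpace (hvol : volume (D : Set (EuclideanSpace ℝ (Fin n))) ≠ ⊤) :
    CompleteSpace (SobolevSol A D hD s p hp) := by
  have hp0 : 0 < p := by linarith
  refine Metric.complete_of_cauchySeq_tendsto fun u hu => ?_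
  have hle : ∀ (u : SobolevSol A D hD s p hp) j, sobENorm s p (u.toDistr j) ≤ ‖u‖ₑ :=
    fun u j => by
      rw [SobolevSol.enorm_def]
      exact le_rpow_sum_rpow hp0 (fun j => sobENorm s p (u.toDistr j)) (Finset.mem_univ j)
  have hex : ∀ j, ∃ S : 𝓓'(D, ℝ),
      (∀ φ, Tendsto (fun i => (u i).toDistr j φ) atTop (𝓝 (S φ))) ∧
      Tendsto (fun i => sobENorm s p ((u i).toDistr j - S)) atTop (𝓝 0) := by
    intro j
    refine distrComplete_sobENorm hvol hp s (fun i => (u i).toDistr j)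
      (fun i => ne_top_of_le_ne_top enorm_ne_top (hle (u i) j)) fun ε hε => ?_
    obtain ⟨K, hK⟩ := EMetric.cauchySeq_iff.1 hu ε hε
    refine ⟨K, fun i hi i' hi' => ?_⟩
    have := hK i hi i' hi'
    rw [edist_eq_enorm_sub] at this
    exact (hle (u i - u i') j).trans_lt this
  choose S hS hlim using hex
  have hvec : Tendsto (fun i => vecENorm s p ((u i).toDistr - S)) atTop (𝓝 0) :=
    tendsto_rpow_sum_rpow hp0 _ fun j _ => hlim j
  have hfin : vecENorm s p S < ⊤ := by
    obtain ⟨i, hi⟩ := (hvec.eventually (gt_mem_nhds ENNReal.zero_lt_top)).exists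
    have h1 := vecENorm_add hp s (u i).toDistr ((-1 : ℝ) • ((u i).toDistr - S))
    have h2 : (u i).toDistr + (-1 : ℝ) • ((u i).toDistr - S) = S := by
      rw [neg_one_smul]; abel
    rw [h2] at h1
    exact h1.trans_lt (ENNReal.add_lt_top.2 ⟨(u i).2.2, (vecENorm_smul hp s _ _).trans_lt
      (ENNReal.mul_lt_top enorm_lt_top hi)⟩)
  have hsol : A.IsSolution D hD S := by
    intro i φ
    have h1 : Tendsto (fun l => ∑ α ∈ multiIdx n m, ∑ j,
        (pderiv 𝓓'(D, ℝ) α ((u l).toDistr j)) (A.mulCoeff hD α i j φ)) atTop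
        (𝓝 (∑ α ∈ multiIdx n m, ∑ j, (pderiv 𝓓'(D, ℝ) α (S j)) (A.mulCoeff hD α i j φ))) := by
      refine tendsto_finsetSum _ fun α _ => tendsto_finsetSum _ fun j _ => ?_
      obtain ⟨ψ, hψ⟩ := exists_pderiv_apply_eq α (A.mulCoeff hD α i j φ)
      simp only [hψ]
      exact hS j ψ
    exact tendsto_nhds_unique h1 (tendsto_const_nhds.congr fun l => ((u l).2.1 i φ).symm)
  let v : SobolevSol A D hD s p hp := ⟨S, hsol, hfin⟩
  refine ⟨v, tendsto_iff_edist_tendsto_0.2 (hvec.congr fun i => ?_)⟩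
  rw [edist_eq_enorm_sub, SobolevSol.enorm_def]
  rfl

end Space

/-! ### Minimization in uniformly convex spaces -/

section Minimization

variable {V : Type*} [NormedAddCommGroup V] [NormedSpace ℝ V] {p : ℝ}

theorem PUniformlyConvex.exists_norm_rpow_le (hp : 0 < p)
    (hV : PUniformlyConvex p fun v : V => ‖v‖ₑ) {ε : ℝ} (hε : 0 < ε) :
    ∃ C : ℝ, 0 ≤ C ∧ ∀ u v : V, ‖u - v‖ ^ p + C * ‖(2⁻¹ : ℝ) • (u + v)‖ ^ p ≤
      (ε + C / 2) * (‖u‖ ^ p + ‖v‖ ^ p) := by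
  obtain ⟨C, hC, h⟩ := hV ε hε
  refine ⟨C, hC, fun u v => ?_⟩
  have h1 := h u v
  have he : ∀ w : V, ‖w‖ₑ ^ p = ENNReal.ofReal (‖w‖ ^ p) := fun w => by
    rw [← ofReal_norm, ENNReal.ofReal_rpow_of_nonneg (norm_nonneg w) hp.le]
  simp only [he] at h1
  rwa [← ENNReal.ofReal_mul hC, ← ENNReal.ofReal_add (by positivity) (by positivity),
    ← ENNReal.ofReal_add (p := ‖u‖ ^ p) (by positivity) (by positivity),
    ← ENNReal.ofReal_mul (by positivity), ENNReal.ofReal_le_ofReal_iff (by positivity)] at h1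

/-- Uniform convexity implies strict convexity. -/
theorem PUniformlyConvex.eq_of_norm_le_norm_midpoint (hp : 0 < p)
    (hV : PUniformlyConvex p fun v : V => ‖v‖ₑ) {u v : V} (huv : ‖u‖ = ‖v‖)
    (hm : ‖u‖ ≤ ‖(2⁻¹ : ℝ) • (u + v)‖) : u = v := by
  have key : ∀ ε : ℝ, 0 < ε → ‖u - v‖ ^ p ≤ 2 * ‖u‖ ^ p * ε := by
    intro ε hε
    obtain ⟨C, hC, h⟩ := hV.exists_norm_rpow_le hp hε
    have h1 := h u v
    have h2 : C * ‖u‖ ^ p ≤ C * ‖(2⁻¹ : ℝ) • (u + v)‖ ^ p := by gcongr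
    rw [← huv] at h1
    linarith
  have h0 : ‖u - v‖ ^ p ≤ 0 := by
    have hcont : Continuous fun ε : ℝ => 2 * ‖u‖ ^ p * ε := by fun_prop
    have hlim := (hcont.tendsto 0).mono_left (nhdsWithin_le_nhds (s := Ioi 0))
    rw [mul_zero] at hlim
    exact ge_of_tendsto hlim (eventually_mem_nhdsWithin.mono key)
  by_contra hne
  exact (Real.rpow_pos_of_pos (norm_pos_iff.2 (sub_ne_zero.2 hne)) p).not_ge h0

/-- In a uniformly convex Banach space, closed convex sets have elements of minimal norm, since
minimizing sequences for the norm are Cauchy. -/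
theorem PUniformlyConvex.exists_isMinOn_norm [CompleteSpace V] (hp : 0 < p)
    (hV : PUniformlyConvex p fun v : V => ‖v‖ₑ) {K : Set V} (hK : IsClosed K) (hKc : Convex ℝ K)
    (hKne : K.Nonempty) : ∃ u ∈ K, IsMinOn norm K u := by
  set d := sInf (norm '' K) with hd
  have hbdd : BddBelow (norm '' K) := ⟨0, by rintro _ ⟨u, -, rfl⟩; exact norm_nonneg u⟩
  have hd0 : 0 ≤ d := le_csInf (hKne.image _) (by rintro _ ⟨u, -, rfl⟩; exact norm_nonneg u)
  have hdle : ∀ u ∈ K, d ≤ ‖u‖ := fun u hu => csInf_le hbdd (mem_image_of_mem _ hu)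
  obtain ⟨x, -, hx, hxK⟩ := exists_seq_tendsto_sInf (hKne.image norm) hbdd
  choose u huK hux using hxK
  rw [← hd, ← funext hux] at hx
  have hpow : Tendsto (fun i => ‖u i‖ ^ p) atTop (𝓝 (d ^ p)) := hx.rpow_const (Or.inr hp.le)
  have hcauchy : CauchySeq u := by
    refine Metric.cauchySeq_iff.2 fun η hη => ?_
    have hηp : 0 < η ^ p := Real.rpow_pos_of_pos hη p
    have hdp : 0 ≤ d ^ p := Real.rpow_nonneg hd0 p
    obtain ⟨C, hC, h⟩ := hV.exists_norm_rpow_le hp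
      (ε := η ^ p / (4 * (d ^ p + 1))) (by positivity)
    set τ := min 1 (η ^ p / (4 * (C + 1))) with hτ
    have hτ0 : 0 < τ := by positivity
    obtain ⟨I, hI⟩ := eventually_atTop.1 (hpow.eventually (gt_mem_nhds (lt_add_of_pos_right _ hτ0)))
    refine ⟨I, fun i hi j hj => ?_⟩
    have h1 := h (u i) (u j)
    have hmem : (2⁻¹ : ℝ) • (u i + u j) ∈ K := by
      rw [smul_add]
      exact hKc (huK i) (huK j) (by norm_num) (by norm_num) (by norm_num)
    have h2 : C * d ^ p ≤ C * ‖(2⁻¹ : ℝ) • (u i + u j)‖ ^ p := by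
      have := hdle _ hmem
      gcongr
    have h3 : ‖u i‖ ^ p + ‖u j‖ ^ p ≤ 2 * (d ^ p + τ) := by
      linarith [hI i hi, hI j hj]
    have h4 : (η ^ p / (4 * (d ^ p + 1)) + C / 2) * (‖u i‖ ^ p + ‖u j‖ ^ p) ≤
        (η ^ p / (4 * (d ^ p + 1)) + C / 2) * (2 * (d ^ p + τ)) := by gcongr
    have h5 : η ^ p / (4 * (d ^ p + 1)) * (2 * (d ^ p + τ)) ≤ η ^ p / 2 := by
      have : τ ≤ 1 := min_le_left _ _
      calc _ ≤ η ^ p / (4 * (d ^ p + 1)) * (2 * (d ^ p + 1)) := by gcongr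
        _ = η ^ p / 2 := by field_simp; norm_num
    have h6 : C * τ ≤ η ^ p / 4 := by
      have : τ ≤ η ^ p / (4 * (C + 1)) := min_le_right _ _
      calc C * τ ≤ (C + 1) * (η ^ p / (4 * (C + 1))) := by gcongr; linarith
        _ = η ^ p / 4 := by field_simp
    have h7 : ‖u i - u j‖ ^ p < η ^ p := by nlinarith
    rw [dist_eq_norm]
    exact (Real.rpow_lt_rpow_iff (norm_nonneg _) hη.le hp).1 h7
  obtain ⟨v, hv⟩ := cauchySeq_tendsto_of_complete hcauchy
  have hvK : v ∈ K := hK.mem_of_tendsto hv (Eventually.of_forall huK)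
  have hvd : ‖v‖ = d := tendsto_nhds_unique hv.norm hx
  exact ⟨v, hvK, fun w hw => hvd.trans_le (hdle w hw)⟩

variable {W : Type*} [NormedAddCommGroup W] [NormedSpace ℝ W]

/-- A proper, coercive, lower semicontinuous function plus a nonnegative continuous one attains its
minimum on a finite-dimensional space. -/
theorem exists_isMinOn_add_coe [FiniteDimensional ℝ W] {F : W → EReal} (hF : IsProper F) (hcoer : IsCoerciveFun F)
    (hlsc : LowerSemicontinuous F) {G : W → ℝ} (hG : Continuous G) (hG0 : ∀ x, 0 ≤ G x) :
    ∃ x₀, F x₀ ≠ ⊤ ∧ IsMinOn (fun x => F x + (G x : EReal)) univ x₀ := by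
  have : ProperSpace W := FiniteDimensional.proper ℝ W
  obtain ⟨hbot, x₁, hx₁⟩ := hF
  set H : W → EReal := fun x => F x + (G x : EReal) with hH
  have hHF : ∀ x, F x ≤ H x := fun x =>
    le_add_of_nonneg_right (EReal.coe_nonneg.2 (hG0 x))
  have hHl : LowerSemicontinuous H :=
    hlsc.add' (continuous_coe_real_ereal.comp hG).lowerSemicontinuous fun x =>
      EReal.continuousAt_add (Or.inr (EReal.coe_ne_bot _)) (Or.inr (EReal.coe_ne_top _))
  have hH₁ : H x₁ < ⊤ := EReal.add_lt_top hx₁ (EReal.coe_ne_top _)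
  have hev : ∀ᶠ x in Bornology.cobounded W, H x₁ < F x := hcoer.eventually (lt_mem_nhds hH₁)
  obtain ⟨R, hR⟩ := (Metric.isBounded_iff_subset_closedBall (0 : W)).1
    (Bornology.isBounded_def.2 (show {x | ¬ H x₁ < F x}ᶜ ∈ Bornology.cobounded W from
      hev.mono fun x hx => not_not.2 hx))
  have hx₁R : x₁ ∈ Metric.closedBall (0 : W) R := hR (not_lt.2 (hHF x₁))
  obtain ⟨x₀, -, hmin⟩ := (hHl.lowerSemicontinuousOn _).exists_isMinOn ⟨x₁, hx₁R⟩
    (isCompact_closedBall (0 : W) R)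
  refine ⟨x₀, fun h => ?_, fun x _ => ?_⟩
  · have h1 : H x₀ ≤ H x₁ := hmin hx₁R
    exact ((top_le_iff.2 h).trans ((hHF x₀).trans h1)).not_gt hH₁
  · by_cases hx : x ∈ Metric.closedBall (0 : W) R
    · exact hmin hx
    · have h1 : H x₁ < F x := by
        by_contra h
        exact hx (hR h)
      exact (hmin hx₁R).trans (h1.le.trans (hHF x))

/-- Existence of minimizers: `u ↦ F (M u) + b ‖u‖` is minimized over each fibre of `M` by an element
of minimal norm, and this minimal norm is a Lipschitz function on the finite-dimensional target. -/
theorem PUniformlyConvex.exists_isMinOn_objective [CompleteSpace V] [FiniteDimensional ℝ W] (hp : 0 < p)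
    (hV : PUniformlyConvex p fun v : V => ‖v‖ₑ) (M : V →L[ℝ] W) (hM : Function.Surjective M)
    {F : W → EReal} (hF : IsProper F) (hcoer : IsCoerciveFun F) (hlsc : LowerSemicontinuous F)
    {b : ℝ} (hb : 0 < b) :
    ∃ u₀ : V, F (M u₀) ≠ ⊤ ∧ IsMinOn (objective F M b) univ u₀ := by
  have hfib : ∀ x : W, ∃ u ∈ M ⁻¹' {x}, IsMinOn norm (M ⁻¹' {x}) u := fun x =>
    hV.exists_isMinOn_norm hp (isClosed_singleton.preimage M.continuous)
      ((convex_singleton x).linear_preimage M.toLinearMap) (hM x)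
  choose σ hσ hmin using hfib
  obtain ⟨R, hR⟩ := M.toLinearMap.exists_rightInverse_of_surjective (LinearMap.range_eq_top.2 hM)
  have hMR : ∀ x, M (R x) = x := fun x => LinearMap.congr_fun hR x
  set R' : W →L[ℝ] V := LinearMap.toContinuousLinearMap R with hR'
  have hG : Continuous fun x => ‖σ x‖ := by
    refine (LipschitzWith.of_le_add_mul ‖R'‖₊ fun x y => ?_).continuous
    have hmem : σ y + R' (x - y) ∈ M ⁻¹' {x} := by
      have h1 : M (σ y) = y := hσ y
      have h2 : M (R' (x - y)) = x - y := hMR _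
      simp [h1, h2, -map_sub]
    calc ‖σ x‖ ≤ ‖σ y + R' (x - y)‖ := hmin x hmem
      _ ≤ ‖σ y‖ + ‖R' (x - y)‖ := norm_add_le _ _
      _ ≤ ‖σ y‖ + ‖R'‖₊ * dist x y := by
        rw [dist_eq_norm]
        gcongr
        exact R'.le_opNorm _
  obtain ⟨x₀, hx₀, hx₀min⟩ := exists_isMinOn_add_coe hF hcoer hlsc (hG.const_mul b)
    fun x => by positivity
  have hMσ : M (σ x₀) = x₀ := hσ x₀
  refine ⟨σ x₀, by rwa [hMσ], fun u _ => ?_⟩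
  have h1 : ‖σ (M u)‖ ≤ ‖u‖ := hmin (M u) (mem_preimage.2 rfl)
  show F (M (σ x₀)) + ((b * ‖σ x₀‖ : ℝ) : EReal) ≤ F (M u) + ((b * ‖u‖ : ℝ) : EReal)
  rw [hMσ]
  refine (hx₀min (mem_univ (M u))).trans (add_le_add le_rfl (EReal.coe_le_coe_iff.2 ?_))
  gcongr

theorem PUniformlyConvex.eq_of_isMinOn_objective (hp : 0 < p)
    (hV : PUniformlyConvex p fun v : V => ‖v‖ₑ) (M : V →L[ℝ] W) {F : W → EReal}
    (hF : IsProper F) (hFs : IsStrictConvexFun F) {b : ℝ} (hb : 0 < b) {u v : V}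
    (hfin : F (M u) ≠ ⊤) (hu : IsMinOn (objective F M b) univ u)
    (hv : IsMinOn (objective F M b) univ v) : u = v := by
  have hvu : F (M v) + ((b * ‖v‖ : ℝ) : EReal) ≤ F (M u) + ((b * ‖u‖ : ℝ) : EReal) :=
    hv (mem_univ u)
  have huv : F (M u) + ((b * ‖u‖ : ℝ) : EReal) ≤ F (M v) + ((b * ‖v‖ : ℝ) : EReal) :=
    hu (mem_univ v)
  have hum : F (M u) + ((b * ‖u‖ : ℝ) : EReal) ≤ F (M ((2⁻¹ : ℝ) • (u + v))) +
      ((b * ‖(2⁻¹ : ℝ) • (u + v)‖ : ℝ) : EReal) := hu (mem_univ _)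
  have hMm : M ((2⁻¹ : ℝ) • (u + v)) = (2⁻¹ : ℝ) • M u + (2⁻¹ : ℝ) • M v := by
    rw [map_smul, map_add, smul_add]
  rw [hMm] at hum
  have hfinv : F (M v) ≠ ⊤ := by
    intro h
    rw [h, EReal.top_add_coe, top_le_iff] at hvu
    exact (EReal.add_lt_top hfin (EReal.coe_ne_top _)).ne hvu
  have hFu := EReal.coe_toReal hfin (hF.1 (M u))
  have hFv := EReal.coe_toReal hfinv (hF.1 (M v))
  set a := (F (M u)).toReal
  set c := (F (M v)).toReal
  rw [← hFu, ← hFv] at huv hvu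
  norm_cast at huv hvu
  by_cases hM : M u = M v
  · have hac : a = c := by
      rw [hM] at hFu
      exact_mod_cast hFu.trans hFv.symm
    have hmid : (2⁻¹ : ℝ) • M u + (2⁻¹ : ℝ) • M v = M u := by
      rw [← hM, ← add_smul]; norm_num
    rw [hmid, ← hFu] at hum
    norm_cast at hum
    refine hV.eq_of_norm_le_norm_midpoint hp ?_ ?_
    · refine le_antisymm (le_of_mul_le_mul_left ?_ hb) (le_of_mul_le_mul_left ?_ hb) <;> linarith
    · exact le_of_mul_le_mul_left (by linarith) hb
  · have hs := hFs (M u) (M v) 2⁻¹ 2⁻¹ hM hfin hfinv (by norm_num) (by norm_num) (by norm_num)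
    have hFm := EReal.coe_toReal hs.ne_top (hF.1 _)
    set e := (F ((2⁻¹ : ℝ) • M u + (2⁻¹ : ℝ) • M v)).toReal
    rw [← hFm, ← hFu, ← hFv] at hs
    rw [← hFm, ← hFu] at hum
    norm_cast at hs hum
    have hn : ‖(2⁻¹ : ℝ) • (u + v)‖ ≤ 2⁻¹ * (‖u‖ + ‖v‖) := by
      rw [norm_smul, Real.norm_of_nonneg (by norm_num : (0 : ℝ) ≤ 2⁻¹)]
      gcongr
      exact norm_add_le u v
    have hn' := mul_le_mul_of_nonneg_left hn hb.le
    exfalso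
    linarith

end Minimization

end SobSol

theorem mainTheorem3 (n k m N : ℕ) (hn : 2 ≤ n) (hk : 1 ≤ k) (hm : 1 ≤ m) (hN : 1 ≤ N)
    (X : Opens (EuclideanSpace ℝ (Fin n)))
    (hX : IsConnected (X : Set (EuclideanSpace ℝ (Fin n))))
    (A : SobSol.DiffOp n k m X) (hA : A.IsElliptic)
    (hUCP : A.HasUCP) (hUCP' : A.AdjointHasUCP)
    (D : Opens (EuclideanSpace ℝ (Fin n))) (hDX : D ≤ X)
    (hDconn : IsConnected (D : Set (EuclideanSpace ℝ (Fin n))))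
    (hDcompact : IsCompact (closure (D : Set (EuclideanSpace ℝ (Fin n)))))
    (hDclosure : closure (D : Set (EuclideanSpace ℝ (Fin n))) ⊆ X)
    (hDsmooth : SobSol.HasSmoothBoundary D)
    (hDcompl : SobSol.NoCompactComponents
      ((X : Set (EuclideanSpace ℝ (Fin n))) \ (D : Set (EuclideanSpace ℝ (Fin n)))))
    (s : ℤ) (p : ℝ) (hp : 1 < p)
    (M : SobSol.SobolevSol A D hDX s p hp →L[ℝ] EuclideanSpace ℝ (Fin N))
    (hM : Function.Surjective M)
    (F : EuclideanSpace ℝ (Fin N) → EReal)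
    (hFproper : SobSol.IsProper F) (hFconvex : SobSol.IsConvexFun F)
    (hFcoercive : SobSol.IsCoerciveFun F) (hFlsc : LowerSemicontinuous F)
    (b : ℝ) (hb : 0 < b) :
    (∃ u₀ : SobSol.SobolevSol A D hDX s p hp, IsMinOn (SobSol.objective F M b) univ u₀) ∧
      (SobSol.IsStrictConvexFun F →
        ∃! u₀ : SobSol.SobolevSol A D hDX s p hp, IsMinOn (SobSol.objective F M b) univ u₀) := by
  have hvol : volume (D : Set (EuclideanSpace ℝ (Fin n))) ≠ ⊤ :=
    ((measure_mono subset_closure).trans_lt hDcompact.measure_lt_top).ne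
  have hcomplete : CompleteSpace (SobSol.SobolevSol A D hDX s p hp) :=
    SobSol.SobolevSol.completeSpace hvol
  have hp0 : 0 < p := by linarith
  have hV := SobSol.SobolevSol.pUniformlyConvex_enorm (A := A) (hD := hDX) (s := s) (hp := hp)
  obtain ⟨u₀, hfin, hu₀⟩ := hV.exists_isMinOn_objective hp0 M hM hFproper hFcoercive hFlsc hb
  exact ⟨⟨u₀, hu₀⟩, fun hF => ⟨u₀, hu₀, fun v hv =>
    (hV.eq_of_isMinOn_objective hp0 M hFproper hF hb hfin hu₀ hv).symm⟩⟩
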